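/- Let $0\le\nu<1$, $w=\tfrac12$ and $\mu=\tfrac{1-\nu}{2}$. For $L\ge 2$ consider diffusion-limited pair annihilation and deposition on the torus $\mathbb Z/L\mathbb Z$: the continuous-time Markov chain on $\{0,1\}^{\mathbb Z/L\mathbb Z}$ in which, for each bond $(k,k+1)$, both occupation numbers $\eta_k,\eta_{k+1}$ are flipped with rate $\mu$ (deposition events) and, independently, with rate $w(\eta_k+\eta_{k+1})$ (particle jumps). Let the activity $A(t)$ be the number of particle jumps up to time $t$, with $A(0)=0$. Then for all $s\in\mathbb R$ and every initial configuration $\eta$ with an even number of particles the limit $$K_L(s)=\lim_{t\to\infty}\frac{1}{Lt}\ln \mathbb E_{\eta}\big[e^{sA(t)}\big]$$ exists with finite expectations, does not depend on $\eta$, and is differentiable in $s$. Let $A_L(s)=K_L'(s)$ be the mean activity, and let $A^c(L)=A_L(s_c)$ be its value at the critical point $s_c=\ln(1-\mu/w)=\ln\nu$; for $\nu=0$, where $s_c=-\infty$, let $A^c(L)=\lim_{s\to-\infty}A_L(s)$ (this limit exists). For every fixed $\nu\in[0,1)$, as $L\to\infty$, $$A^c(L)=\kappa_1^\ast+\frac{\nu(1-2\nu)}{\sqrt{1-\nu^2}}\,\frac{\pi}{24L^2}+O(L^{-4}),\qquad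 \kappa_1^\ast=\frac1\pi\left(\sqrt{1-\nu^2}-\frac{1-\nu}{\nu}\arcsin\nu\right),$$ where for $\nu=0$ the constant $\kappa_1^\ast$ is understood as its limit $0$ for $\nu\to0$. -/

import Mathlib

open Filter Topology Asymptotics

noncomputable section

namespace DLPAD

/-- Configurations on the integer torus `ℤ/Lℤ`; `η k = true` means that site `k` is occupied. -/
abbrev Config (L : ℕ) : Type := ZMod L → Bool

/-- The occupation number `η_k ∈ {0, 1}` as a real number. -/
def occ {L : ℕ} (η : Config L) (k : ZMod L) : ℝ := if η k then 1 else 0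

/-- The configuration in which the occupation numbers at `k` and `k + 1` are flipped. -/
def flip {L : ℕ} (η : Config L) (k : ZMod L) : Config L :=
  fun j => if j = k ∨ j = k + 1 then !(η j) else η j

/-- The total particle number. -/
def particleNumber {L : ℕ} [NeZero L] (η : Config L) : ℕ :=
  ∑ k : ZMod L, if η k then 1 else 0

/-- State space of the joint process `(η(t), A(t))`: configuration and number of jumps so far. -/
abbrev JointState (L : ℕ) : Type := Config L × ℕ

/-- The generator of the joint process: on every bond a pair flip occurs with deposition rate `μ`,
leaving `A` unchanged, and with jump rate `w (η_k + η_{k+1})`, raising `A` by one. The first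
component alone is diffusion-limited pair annihilation and deposition. -/
def jointGenerator (w μ : ℝ) (L : ℕ) [NeZero L] (f : JointState L → ℝ) : JointState L → ℝ :=
  fun x => ∑ k : ZMod L,
    (μ * f (flip x.1 k, x.2)
      + w * (occ x.1 k + occ x.1 (k + 1)) * f (flip x.1 k, x.2 + 1)
      - (μ + w * (occ x.1 k + occ x.1 (k + 1))) * f x)

/-- The Markov semigroup `exp (t 𝓗) f = ∑ₙ tⁿ/n! 𝓗ⁿ f` of the joint process. The transition rates
are bounded, so the series converges absolutely for every bounded `f`. -/
def semigroup (w μ : ℝ) (L : ℕ) [NeZero L] (t : ℝ) (f : JointState L → ℝ) (x : JointState L) : ℝ :=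
  ∑' n : ℕ, t ^ n / (n.factorial : ℝ) * ((jointGenerator w μ L)^[n] f) x

open Classical in
/-- The probability that the joint process started in `x` is in the state `y` at time `t`. -/
def transitionProb (w μ : ℝ) (L : ℕ) [NeZero L] (t : ℝ) (x y : JointState L) : ℝ :=
  semigroup w μ L t (fun z => if z = y then 1 else 0) x

/-- The moment generating function `E_{η,0} [exp (s A(t))]` of the activity `A(t)`, for the process
started in the configuration `η` with `A(0) = 0`. -/
def activityMGF (w μ : ℝ) (L : ℕ) [NeZero L] (η : Config L) (s t : ℝ) : ℝ :=
  ∑' y : JointState L, Real.exp (s * y.2) * transitionProb w μ L t (η, 0) y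

/-- `K` is the limiting cumulant generating function of the activity per site and unit time in the
even sector: for every initial configuration with an even number of particles and all `s`, the
moment generating function of `A(t)` is finite and
`K s = lim_{t → ∞} (1 / (L t)) log E_{η,0} [exp (s A(t))]`. -/
def IsEvenCGF (w μ : ℝ) (L : ℕ) [NeZero L] (K : ℝ → ℝ) : Prop :=
  ∀ η : Config L, Even (particleNumber η) → ∀ s : ℝ,
    (∀ t : ℝ, 0 < t →
      Summable fun y : JointState L => Real.exp (s * y.2) * transitionProb w μ L t (η, 0) y) ∧
    Tendsto (fun t : ℝ => Real.log (activityMGF w μ L η s t) / (L * t)) atTop (𝓝 (K s))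

/-- The critical point `s_c = log (1 - μ/w)` (a real number for `0 < μ < w`). -/
def criticalPoint (w μ : ℝ) : ℝ := Real.log (1 - μ / w)

/-- The asymptotic critical mean activity; at `ν = 0` it is the limit as `ν → 0`, which is `0`. -/
def kappaStarOne (ν : ℝ) : ℝ :=
  if ν = 0 then 0
  else 1 / Real.pi * (Real.sqrt (1 - ν ^ 2) - (1 - ν) / ν * Real.arcsin ν)

end DLPAD

end

/-! Counting jumps with weight `exp s` reduces the moment generating function to `exp (t T)` applied
to the constant function `1`, where T is the tilted generator on the finite configuration space
(`activityMGF_eq_tsum`). A function φ which is positive on the even sector and satisfies T φ = Λ φ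
there gives c⁻¹ φ ≤ 1 ≤ C φ on that sector. Positivity of the semigroup then sandwiches the moment
generating function between multiples of exp(Λ t), so the limit is Λ / L
(`tendsto_log_activityMGF`).

For w = 1/2 the operator T is a free fermion. Conjugation by a product weight makes it symmetric,
with pair creation and annihilation at rate b = √(μ(μ + exp s)) and hopping at rate a = μ + exp s /
2. The Jordan–Wigner transformation turns it into a quadratic form in Majorana operators, which on
even vectors are antiperiodic; this selects momenta π(2j+1)/L. In Fourier space the top value minus
the operator is a positive combination of terms B*B with Bogoliubov operators B (`sum_bogoliubov`).
Hence the top value is half the sum of the moduli of the symbol, and it is attained exactly on the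
joint kernel of the B's. A kernel vector is built by applying pairs of B's to the vacuum
(`exists_groundState`). Its absolute value is again a maximizer, since off-diagonal rates are
nonnegative, and connectivity of the even sector under pair flips makes it strictly positive.

The generating function is therefore an explicit finite sum over momenta. At the critical point the
gap closes: with half momentum θ = q/2 the dispersion is 2 sin θ √(1 - ν² cos² θ), and the mean
activity is a midpoint sum over [0, π] of a function smooth on the whole line
(`meanActivity_critical`). The midpoint rule with its first correction (`abs_midpoint_sum_le`)
yields the integral κ₁*, the L⁻² term from the slopes at the two endpoints, and an O(L⁻⁴) remainder.
-/

namespace DLPAD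

/-! ### Corrected midpoint rule -/

section MidpointRule

/-- Integrating a power bound on a derivative. -/
lemma abs_le_of_abs_deriv_le {g g' : ℝ → ℝ} {C : ℝ} {n : ℕ} (h0 : g 0 = 0)
    (hd : ∀ x, HasDerivAt g (g' x) x) (hb : ∀ x, 0 ≤ x → |g' x| ≤ C * x ^ n) {x : ℝ} (hx : 0 ≤ x) :
    |g x| ≤ C * x ^ (n + 1) := by
  have hC : 0 ≤ C * x ^ n := (abs_nonneg _).trans (hb x hx)
  have key : ∀ y ∈ Set.Icc 0 x, ‖g y - g 0‖ ≤ (C * x ^ n) * (y - 0) := by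
    refine norm_image_sub_le_of_norm_deriv_le_segment' (f' := g')
      (fun y _ => (hd y).hasDerivWithinAt) fun y hy => ?_
    rw [Real.norm_eq_abs]
    rcases hx.eq_or_lt with rfl | hx'
    · exact absurd hy.2 (not_lt.mpr hy.1)
    · have hC' : 0 ≤ C := nonneg_of_mul_nonneg_left hC (by positivity)
      refine (hb y hy.1).trans ?_
      have := hy.1
      have := hy.2.le
      gcongr
  have := key x ⟨hx, le_rfl⟩
  rw [h0, sub_zero, sub_zero, Real.norm_eq_abs] at this
  calc _ ≤ _ := this
    _ = _ := by ring

/-- One step of the corrected midpoint rule: `F` is a primitive of `f 0`, and `f (i + 1)` is the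
derivative of `f i`. -/
lemma abs_midpoint_step_le {F : ℝ → ℝ} {f : ℕ → ℝ → ℝ} (hF : ∀ x, HasDerivAt F (f 0 x) x)
    (hf : ∀ i x, HasDerivAt (f i) (f (i + 1) x) x) {M : ℝ} (hM : ∀ x, |f 4 x| ≤ M) (c : ℝ)
    {δ : ℝ} (hδ : 0 ≤ δ) :
    |F (c + δ) - F (c - δ) - δ ^ 2 / 6 * (f 1 (c + δ) - f 1 (c - δ)) - 2 * δ * f 0 c|
      ≤ 7 / 3 * M * δ ^ 5 := by
  have hp : ∀ {g g' : ℝ → ℝ}, (∀ x, HasDerivAt g (g' x) x) → ∀ x,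
      HasDerivAt (fun x => g (c + x)) (g' (c + x)) x := fun hg x =>
    (hg (c + x)).comp_const_add c x
  have hm : ∀ {g g' : ℝ → ℝ}, (∀ x, HasDerivAt g (g' x) x) → ∀ x,
      HasDerivAt (fun x => g (c - x)) (-g' (c - x)) x := fun hg x =>
    (hg (c - x)).comp_const_sub c x
  have h3 : ∀ x, 0 ≤ x → |f 3 (c + x) - f 3 (c - x)| ≤ 2 * M * x := by
    intro x hx
    have := abs_le_of_abs_deriv_le (g := fun x => f 3 (c + x) - f 3 (c - x)) (C := 2 * M) (n := 0)
      (by simp) (fun x => (hp (hf 3) x).sub (hm (hf 3) x)) (fun x _ => by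
        have a := abs_le.mp (hM (c + x))
        have b := abs_le.mp (hM (c - x))
        rw [abs_le]; constructor <;> linarith) hx
    simpa using this
  -- third derivative of the error
  have e3 : ∀ x, 0 ≤ x → |-x * (f 3 (c + x) - f 3 (c - x)) -
      x ^ 2 / 6 * (f 4 (c + x) + f 4 (c - x))| ≤ 7 / 3 * M * x ^ 2 := by
    intro x hx
    have a := abs_le.mp (hM (c + x))
    have b := abs_le.mp (hM (c - x))
    have h := abs_le.mp (h3 x hx)
    have q := sq_nonneg x
    rw [abs_le]
    constructor <;> nlinarith [mul_le_mul_of_nonneg_left h.1 hx, mul_le_mul_of_nonneg_left h.2 hx,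
      mul_le_mul_of_nonneg_left a.1 q, mul_le_mul_of_nonneg_left a.2 q,
      mul_le_mul_of_nonneg_left b.1 q, mul_le_mul_of_nonneg_left b.2 q]
  have hid : ∀ x : ℝ, HasDerivAt (fun x : ℝ => x) 1 x := fun x => hasDerivAt_id x
  have hsq : ∀ x : ℝ, HasDerivAt (fun x : ℝ => x ^ 2 / 6) (x / 3) x := fun x => by
    exact (((hid x).pow 2).div_const 6).congr_deriv (by norm_num; ring)
  have e2 : ∀ x, 0 ≤ x → |2 / 3 * (f 1 (c + x) - f 1 (c - x)) - 2 / 3 * (x * (f 2 (c + x) + f 2 (c - x)))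
      - x ^ 2 / 6 * (f 3 (c + x) - f 3 (c - x))| ≤ 7 / 3 * M * x ^ 3 := by
    intro x hx
    have := abs_le_of_abs_deriv_le (g := fun x => 2 / 3 * (f 1 (c + x) - f 1 (c - x))
      - 2 / 3 * (x * (f 2 (c + x) + f 2 (c - x))) - x ^ 2 / 6 * (f 3 (c + x) - f 3 (c - x)))
      (by simp) (fun x => ((((hp (hf 1) x).sub (hm (hf 1) x)).const_mul (2 / 3)).sub
        (((hid x).mul ((hp (hf 2) x).add (hm (hf 2) x))).const_mul (2 / 3))).sub
        ((hsq x).mul ((hp (hf 3) x).sub (hm (hf 3) x)))) (n := 2) (C := 7 / 3 * M) (fun x hx => by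
        refine le_trans (le_of_eq ?_) (e3 x hx)
        congr 1; simp only [Pi.add_apply, Pi.sub_apply]; ring) hx
    exact this
  have e1 : ∀ x, 0 ≤ x → |(f 0 (c + x) + f 0 (c - x)) - 2 * f 0 c
      - x / 3 * (f 1 (c + x) - f 1 (c - x)) - x ^ 2 / 6 * (f 2 (c + x) + f 2 (c - x))|
      ≤ 7 / 3 * M * x ^ 4 := by
    intro x hx
    exact abs_le_of_abs_deriv_le (g := fun x => (f 0 (c + x) + f 0 (c - x)) - 2 * f 0 c
      - x / 3 * (f 1 (c + x) - f 1 (c - x)) - x ^ 2 / 6 * (f 2 (c + x) + f 2 (c - x)))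
      (by simp; ring) (fun x => ((((hp (hf 0) x).add (hm (hf 0) x)).sub_const _).sub
        (((hid x).div_const 3).mul ((hp (hf 1) x).sub (hm (hf 1) x)))).sub
        ((hsq x).mul ((hp (hf 2) x).add (hm (hf 2) x)))) (n := 3) (C := 7 / 3 * M) (fun x hx => by
        refine le_trans (le_of_eq ?_) (e2 x hx)
        congr 1; simp only [Pi.add_apply, Pi.sub_apply]; ring) hx
  exact abs_le_of_abs_deriv_le (g := fun x => F (c + x) - F (c - x)
      - x ^ 2 / 6 * (f 1 (c + x) - f 1 (c - x)) - 2 * x * f 0 c)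
      (by simp) (fun x => (((hp hF x).sub (hm hF x)).sub
        ((hsq x).mul ((hp (hf 1) x).sub (hm (hf 1) x)))).sub
        (((hid x).const_mul 2).mul_const _)) (n := 4) (C := 7 / 3 * M) (fun x hx => by
        refine le_trans (le_of_eq ?_) (e1 x hx)
        congr 1; simp only [Pi.sub_apply]; ring) hδ

/-- The midpoint rule with its first correction term. -/
lemma abs_midpoint_sum_le {F : ℝ → ℝ} {f : ℕ → ℝ → ℝ} (hF : ∀ x, HasDerivAt F (f 0 x) x)
    (hf : ∀ i x, HasDerivAt (f i) (f (i + 1) x) x) {M : ℝ} (hM : ∀ x, |f 4 x| ≤ M) {b : ℝ}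
    (hb : 0 ≤ b) {n : ℕ} (hn : 0 < n) :
    |b / n * ∑ j ∈ Finset.range n, f 0 (b * (2 * j + 1) / (2 * n))
      - (F b - F 0 - b ^ 2 / (24 * n ^ 2) * (f 1 b - f 1 0))| ≤ 7 / 96 * M * b ^ 5 / n ^ 4 := by
  have hn' : (0 : ℝ) < n := by exact_mod_cast hn
  -- With δ = b / (2n) the step correction δ²/6 is b²/(24 n²), and both it and the primitive
  -- telescope over the n cells.
  set G : ℕ → ℝ := fun j => F (b * j / n) - b ^ 2 / (24 * n ^ 2) * f 1 (b * j / n) with hG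
  have hstep : ∀ j ∈ Finset.range n, |(G (j + 1) - G j)
      - b / n * f 0 (b * (2 * j + 1) / (2 * n))| ≤ 7 / 3 * M * (b / (2 * n)) ^ 5 := by
    intro j _
    refine le_trans (le_of_eq ?_)
      (abs_midpoint_step_le hF hf hM (b * (2 * j + 1) / (2 * n)) (δ := b / (2 * n)) (by positivity))
    have e1 : b * (2 * j + 1) / (2 * n) + b / (2 * n) = b * (j + 1 : ℕ) / n := by
      push_cast; field_simp; ring
    have e2 : b * (2 * j + 1) / (2 * n) - b / (2 * n) = b * j / n := by
      field_simp; ring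
    rw [e1, e2]
    congr 1
    simp only [hG]
    field_simp
    ring
  have hsum := (Finset.abs_sum_le_sum_abs _ _).trans (Finset.sum_le_sum hstep)
  rw [Finset.sum_sub_distrib, Finset.sum_range_sub, ← Finset.mul_sum, Finset.sum_const,
    Finset.card_range, nsmul_eq_mul, abs_sub_comm] at hsum
  have e3 : G n - G 0 = F b - F 0 - b ^ 2 / (24 * n ^ 2) * (f 1 b - f 1 0) := by
    simp only [hG]
    rw [mul_div_assoc, div_self hn'.ne']
    simp; ring
  rw [e3] at hsum
  refine hsum.trans (le_of_eq ?_)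
  field_simp
  ring

end MidpointRule

/-! ### Moment generating function and growth rate -/

section Semigroup

variable {L : ℕ} [NeZero L]

open Classical in
/-- The indicator function of a joint state. -/
noncomputable def pointMass (y : JointState L) : JointState L → ℝ := fun z => if z = y then 1 else 0

/-- The generator tilted by the activity, acting on functions of the configuration. -/
noncomputable def tiltedGenerator (w μ s : ℝ) (L : ℕ) [NeZero L] : Module.End ℝ (Config L → ℝ) where
  toFun f η := ∑ k : ZMod L,
    ((μ + w * (occ η k + occ η (k + 1)) * Real.exp s) * f (flip η k)
      - (μ + w * (occ η k + occ η (k + 1))) * f η)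
  map_add' f g := by
    ext η; simp only [Pi.add_apply, ← Finset.sum_add_distrib]
    exact Finset.sum_congr rfl fun k _ => by ring
  map_smul' c f := by
    ext η; simp only [Pi.smul_apply, smul_eq_mul, Finset.mul_sum, RingHom.id_apply]
    exact Finset.sum_congr rfl fun k _ => by ring

lemma tiltedGenerator_apply (w μ s : ℝ) (f : Config L → ℝ) (η : Config L) :
    tiltedGenerator w μ s L f η = ∑ k : ZMod L,
    ((μ + w * (occ η k + occ η (k + 1)) * Real.exp s) * f (flip η k)
      - (μ + w * (occ η k + occ η (k + 1))) * f η) := rfl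

omit [NeZero L] in
lemma occ_nonneg (η : Config L) (k : ZMod L) : 0 ≤ occ η k := by
  unfold occ; split_ifs <;> norm_num

omit [NeZero L] in
lemma occ_le_one (η : Config L) (k : ZMod L) : occ η k ≤ 1 := by
  unfold occ; split_ifs <;> norm_num

/-- The joint generator sends `exp (s A) f(η)` to `exp (s A) (T f)(η)`, because a jump multiplies
the weight by `exp s`. As this weight can be unbounded in A, it is expanded in point masses, and the
induction only combines finitely many convergent sums at each step. -/
lemma hasSum_iterate_pointMass (w μ s : ℝ) (n : ℕ) (x : JointState L) :
    HasSum (fun y : JointState L =>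
        Real.exp (s * y.2) * ((jointGenerator w μ L)^[n] (pointMass y)) x)
      (Real.exp (s * x.2) * ((tiltedGenerator w μ s L)^[n] (fun _ => 1)) x.1) := by
  induction n generalizing x with
  | zero =>
    have := hasSum_single (f := fun y : JointState L =>
        Real.exp (s * y.2) * pointMass y x) x (by
      intro y hy; simp [pointMass, hy.symm])
    simpa [pointMass] using this
  | succ n ih =>
    have key := hasSum_sum (s := (Finset.univ : Finset (ZMod L))) fun k _ =>
      (((ih (flip x.1 k, x.2)).mul_left μ).add
        ((ih (flip x.1 k, x.2 + 1)).mul_left (w * (occ x.1 k + occ x.1 (k + 1))))).sub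
        ((ih x).mul_left (μ + w * (occ x.1 k + occ x.1 (k + 1))))
    simp only [Function.iterate_succ_apply']
    have hv : Real.exp (s * x.2) * tiltedGenerator w μ s L
        ((tiltedGenerator w μ s L)^[n] (fun _ => 1)) x.1 = ∑ k : ZMod L,
        (μ * (Real.exp (s * x.2) * ((tiltedGenerator w μ s L)^[n] (fun _ => 1)) (flip x.1 k))
        + w * (occ x.1 k + occ x.1 (k + 1)) * (Real.exp (s * (x.2 + 1 : ℕ)) *
          ((tiltedGenerator w μ s L)^[n] (fun _ => 1)) (flip x.1 k))
        - (μ + w * (occ x.1 k + occ x.1 (k + 1))) * (Real.exp (s * x.2) *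
          ((tiltedGenerator w μ s L)^[n] (fun _ => 1)) x.1)) := by
      rw [tiltedGenerator_apply, Finset.mul_sum]
      refine Finset.sum_congr rfl fun k _ => ?_
      have : Real.exp (s * ((x.2 + 1 : ℕ) : ℝ)) = Real.exp (s * x.2) * Real.exp s := by
        rw [← Real.exp_add]; push_cast; ring_nf
      rw [this]; ring
    rw [hv]
    refine Eq.mp (congrArg (fun h => HasSum h _) (funext fun y => ?_)) key
    simp only [jointGenerator, Finset.mul_sum]
    exact Finset.sum_congr rfl fun k _ => by ring

/-- Each bond contributes at most μ for deposition, 2w `exp s` for a jump and μ + 2w for the holding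
term. This geometric bound is what makes the double series over n and over final states absolutely
summable. -/
lemma sum_abs_iterate_pointMass_le {w μ : ℝ} (hw : 0 ≤ w) (hμ : 0 ≤ μ) (s : ℝ) (n : ℕ)
    (F : Finset (JointState L)) (x : JointState L) :
    ∑ y ∈ F, Real.exp (s * y.2) * |((jointGenerator w μ L)^[n] (pointMass y)) x|
      ≤ Real.exp (s * x.2) * (L * (2 * μ + 2 * w * (1 + Real.exp s))) ^ n := by
  induction n generalizing x with
  | zero =>
    have : ∀ y ∈ F, Real.exp (s * y.2) * |((jointGenerator w μ L)^[0] (pointMass y)) x|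
        ≤ if y = x then Real.exp (s * x.2) else 0 := by
      intro y _
      by_cases h : y = x
      · simp [pointMass, h]
      · simp [pointMass, h, Ne.symm h]
    refine (Finset.sum_le_sum this).trans ?_
    rw [Finset.sum_ite_eq']
    split_ifs <;> simp [Real.exp_nonneg]
  | succ n ih =>
    simp only [Function.iterate_succ_apply']
    set C := (L * (2 * μ + 2 * w * (1 + Real.exp s)) : ℝ) with hC
    have hC0 : 0 ≤ C := by positivity
    set g : JointState L → JointState L → ℝ := fun y => (jointGenerator w μ L)^[n] (pointMass y)
    have h1 : ∀ y ∈ F, Real.exp (s * y.2) * |jointGenerator w μ L (g y) x| ≤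
        ∑ k : ZMod L, (μ * (Real.exp (s * y.2) * |g y (flip x.1 k, x.2)|)
          + 2 * w * (Real.exp (s * y.2) * |g y (flip x.1 k, x.2 + 1)|)
          + (μ + 2 * w) * (Real.exp (s * y.2) * |g y x|)) := by
      intro y _
      have : |jointGenerator w μ L (g y) x| ≤ ∑ k : ZMod L, (μ * |g y (flip x.1 k, x.2)|
          + 2 * w * |g y (flip x.1 k, x.2 + 1)| + (μ + 2 * w) * |g y x|) := by
        refine (Finset.abs_sum_le_sum_abs _ _).trans (Finset.sum_le_sum fun k _ => ?_)
        have o1 := occ_nonneg x.1 k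
        have o2 := occ_nonneg x.1 (k + 1)
        have o3 := occ_le_one x.1 k
        have o4 := occ_le_one x.1 (k + 1)
        have hr : w * (occ x.1 k + occ x.1 (k + 1)) ≤ 2 * w := by nlinarith
        have hr0 : 0 ≤ w * (occ x.1 k + occ x.1 (k + 1)) := by positivity
        refine (abs_sub _ _).trans ?_
        refine add_le_add ((abs_add_le _ _).trans (add_le_add ?_ ?_)) ?_
        · rw [abs_mul, abs_of_nonneg hμ]
        · rw [abs_mul, abs_of_nonneg hr0]; gcongr
        · rw [abs_mul, abs_of_nonneg (by linarith)]; gcongr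
      refine (mul_le_mul_of_nonneg_left this (Real.exp_nonneg _)).trans (le_of_eq ?_)
      rw [Finset.mul_sum]
      exact Finset.sum_congr rfl fun k _ => by ring
    refine (Finset.sum_le_sum h1).trans ?_
    rw [Finset.sum_comm]
    have h2 : ∀ k ∈ (Finset.univ : Finset (ZMod L)),
        ∑ y ∈ F, (μ * (Real.exp (s * y.2) * |g y (flip x.1 k, x.2)|)
          + 2 * w * (Real.exp (s * y.2) * |g y (flip x.1 k, x.2 + 1)|)
          + (μ + 2 * w) * (Real.exp (s * y.2) * |g y x|)) ≤
        (2 * μ + 2 * w * (1 + Real.exp s)) * (Real.exp (s * x.2) * C ^ n) := by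
      intro k _
      simp only [Finset.sum_add_distrib, ← Finset.mul_sum]
      have e1 := ih (flip x.1 k, x.2)
      have e2 := ih (flip x.1 k, x.2 + 1)
      have e3 := ih x
      have e4 : Real.exp (s * ((x.2 + 1 : ℕ) : ℝ)) = Real.exp (s * x.2) * Real.exp s := by
        rw [← Real.exp_add]; push_cast; ring_nf
      simp only [e4] at e2
      have e1' := mul_le_mul_of_nonneg_left e1 hμ
      have e2' := mul_le_mul_of_nonneg_left e2 (by positivity : 0 ≤ 2 * w)
      have e3' := mul_le_mul_of_nonneg_left e3 (by positivity : 0 ≤ μ + 2 * w)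
      simp only [g] at *
      refine (add_le_add (add_le_add e1' e2') e3').trans (le_of_eq ?_)
      ring
    refine (Finset.sum_le_sum h2).trans (le_of_eq ?_)
    simp only [Finset.sum_const, Finset.card_univ, ZMod.card, nsmul_eq_mul]
    rw [hC]; ring

lemma summable_semigroup_pointMass {w μ : ℝ} (hw : 0 ≤ w) (hμ : 0 ≤ μ) (s : ℝ) {t : ℝ}
    (ht : 0 ≤ t) (x : JointState L) :
    Summable fun p : ℕ × JointState L => t ^ p.1 / (p.1.factorial : ℝ) *
      (Real.exp (s * p.2.2) * ((jointGenerator w μ L)^[p.1] (pointMass p.2)) x) := by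
  have hb := fun n F => sum_abs_iterate_pointMass_le (L := L) hw hμ s n F x
  set C := (L * (2 * μ + 2 * w * (1 + Real.exp s)) : ℝ) with hC
  have hsum : ∀ n : ℕ, Summable fun y : JointState L =>
      Real.exp (s * y.2) * |((jointGenerator w μ L)^[n] (pointMass y)) x| := fun n =>
    summable_of_sum_le (fun y => by positivity) (hb n)
  apply Summable.of_abs
  rw [summable_prod_of_nonneg (fun p => abs_nonneg _)]
  simp only [abs_mul, Real.abs_exp, abs_div, abs_pow, Nat.abs_cast, abs_of_nonneg ht]
  refine ⟨fun n => (hsum n).mul_left _, ?_⟩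
  simp only [tsum_mul_left]
  refine Summable.of_nonneg_of_le (fun n => mul_nonneg (by positivity)
    (tsum_nonneg fun y => by positivity)) (fun n => mul_le_mul_of_nonneg_left
      ((hsum n).tsum_le_of_sum_le (hb n)) (by positivity)) ?_
  have := (Real.summable_pow_div_factorial (t * C)).mul_left (Real.exp (s * x.2))
  refine this.congr fun n => ?_
  rw [mul_pow]; ring

lemma transitionProb_eq (w μ t : ℝ) (x y : JointState L) : transitionProb w μ L t x y =
    ∑' n : ℕ, t ^ n / (n.factorial : ℝ) * ((jointGenerator w μ L)^[n] (pointMass y)) x := rfl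

lemma summable_activityMGF {w μ : ℝ} (hw : 0 ≤ w) (hμ : 0 ≤ μ) (s : ℝ) {t : ℝ}
    (ht : 0 ≤ t) (x : JointState L) :
    Summable fun y : JointState L => Real.exp (s * y.2) * transitionProb w μ L t x y := by
  have h := (summable_semigroup_pointMass (L := L) hw hμ s ht x).prod_symm.prod
  refine h.congr fun y => ?_
  rw [transitionProb_eq, ← tsum_mul_left]
  exact tsum_congr fun n => by simp only [Prod.swap_prod_mk]; ring

lemma activityMGF_eq_tsum {w μ : ℝ} (hw : 0 ≤ w) (hμ : 0 ≤ μ) (s : ℝ) {t : ℝ}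
    (ht : 0 ≤ t) (η : Config L) :
    activityMGF w μ L η s t =
      ∑' n : ℕ, t ^ n / (n.factorial : ℝ) * ((tiltedGenerator w μ s L)^[n] (fun _ => 1)) η := by
  have h := summable_semigroup_pointMass (L := L) hw hμ s ht (η, 0)
  have h1 : activityMGF w μ L η s t = ∑' y : JointState L, ∑' n : ℕ,
      t ^ n / (n.factorial : ℝ) *
      (Real.exp (s * y.2) * ((jointGenerator w μ L)^[n] (pointMass y)) (η, 0)) := by
    unfold activityMGF
    refine tsum_congr fun y => ?_
    rw [transitionProb_eq, ← tsum_mul_left]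
    exact tsum_congr fun n => by ring
  rw [h1, h.tsum_comm]
  refine tsum_congr fun n => ?_
  rw [tsum_mul_left, (hasSum_iterate_pointMass w μ s n (η, 0)).tsum_eq]
  simp

lemma tsum_iterate_eq_exp (T : Module.End ℝ (Config L → ℝ)) (t : ℝ) (f : Config L → ℝ)
    (η : Config L) :
    ∑' n : ℕ, t ^ n / (n.factorial : ℝ) * (T^[n] f) η =
      NormedSpace.exp (t • LinearMap.toContinuousLinearMap T) f η := by
  have h := NormedSpace.exp_series_hasSum_exp' (𝕂 := ℝ) (t • LinearMap.toContinuousLinearMap T)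
  have h2 := ((ContinuousLinearMap.proj (R := ℝ) η).comp
    (ContinuousLinearMap.apply ℝ (Config L → ℝ) f)).hasSum h
  rw [show NormedSpace.exp (t • LinearMap.toContinuousLinearMap T) f η =
    ((ContinuousLinearMap.proj (R := ℝ) η).comp
    (ContinuousLinearMap.apply ℝ (Config L → ℝ) f))
      (NormedSpace.exp (t • LinearMap.toContinuousLinearMap T)) from rfl, ← h2.tsum_eq]
  refine tsum_congr fun n => ?_
  have hn : ∀ n : ℕ, ((LinearMap.toContinuousLinearMap T) ^ n) f = T^[n] f := by
    intro n
    induction n with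
    | zero => simp
    | succ n ih => rw [pow_succ', Function.iterate_succ_apply', ← ih]; rfl
  simp only [ContinuousLinearMap.comp_apply, map_smul,
    ContinuousLinearMap.apply_apply, smul_pow, hn, ContinuousLinearMap.proj_apply, smul_eq_mul]
  rw [div_eq_inv_mul, mul_assoc]

/-- A linear operator with nonnegative off-diagonal part relative to a set `S` of configurations
generates a semigroup which is positive on `S`. -/
lemma exp_nonneg_on {S : Set (Config L)} (T : Module.End ℝ (Config L → ℝ)) (D : ℝ)
    (hT : ∀ f : Config L → ℝ, (∀ η ∈ S, 0 ≤ f η) → ∀ η ∈ S, 0 ≤ T f η + D * f η)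
    {t : ℝ} (ht : 0 ≤ t) {f : Config L → ℝ} (hf : ∀ η ∈ S, 0 ≤ f η) {η : Config L} (hη : η ∈ S) :
    0 ≤ NormedSpace.exp (t • LinearMap.toContinuousLinearMap T) f η := by
  set U : Module.End ℝ (Config L → ℝ) := T + D • 1 with hU
  have hpos : ∀ n : ℕ, ∀ η ∈ S, 0 ≤ (U^[n] f) η := by
    intro n
    induction n with
    | zero => simpa using hf
    | succ n ih =>
      intro η hη
      rw [Function.iterate_succ_apply']
      exact hT _ ih η hη
  -- Since exp(tT) = exp(-tD) exp(t(T + D)), it suffices that all powers of T + D preserve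
  -- nonnegativity on S.
  have h1 : t • LinearMap.toContinuousLinearMap T =
      t • LinearMap.toContinuousLinearMap U + (-(t * D)) • (1 : (Config L → ℝ) →L[ℝ] _) := by
    ext f η
    simp [hU]; ring
  have hc : Commute (t • LinearMap.toContinuousLinearMap U)
      ((-(t * D)) • (1 : (Config L → ℝ) →L[ℝ] (Config L → ℝ))) :=
    (Commute.one_right _).smul_right _
  have h2 : NormedSpace.exp ((-(t * D)) • (1 : (Config L → ℝ) →L[ℝ] (Config L → ℝ))) =
      Real.exp (-(t * D)) • 1 := by
    rw [← Algebra.algebraMap_eq_smul_one, ← Algebra.algebraMap_eq_smul_one,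
      Real.exp_eq_exp_ℝ, NormedSpace.algebraMap_exp_comm]
  let _ : NormedAlgebra ℚ ((Config L → ℝ) →L[ℝ] (Config L → ℝ)) := .restrictScalars ℚ ℝ _
  rw [h1, NormedSpace.exp_add_of_commute hc, h2, mul_smul_comm, mul_one]
  change 0 ≤ Real.exp (-(t * D)) * (NormedSpace.exp (t • LinearMap.toContinuousLinearMap U) f η)
  refine mul_nonneg (Real.exp_nonneg _) ?_
  rw [← tsum_iterate_eq_exp]
  exact tsum_nonneg fun n => mul_nonneg (by positivity) (hpos n η hη)

/-- A function which is an eigenfunction of `T` on an invariant set `S` evolves exponentially. -/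
lemma exp_eigen_on {S : Set (Config L)} (T : Module.End ℝ (Config L → ℝ)) {Λ : ℝ}
    (hT : ∀ f g : Config L → ℝ, (∀ η ∈ S, f η = g η) → ∀ η ∈ S, T f η = T g η)
    {φ : Config L → ℝ} (hφ : ∀ η ∈ S, T φ η = Λ * φ η) (t : ℝ) {η : Config L} (hη : η ∈ S) :
    NormedSpace.exp (t • LinearMap.toContinuousLinearMap T) φ η = Real.exp (Λ * t) * φ η := by
  have hit : ∀ n : ℕ, ∀ η ∈ S, (T^[n] φ) η = Λ ^ n * φ η := by
    intro n
    induction n with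
    | zero => simp
    | succ n ih =>
      intro η hη
      rw [Function.iterate_succ_apply', hT (T^[n] φ) (Λ ^ n • φ) ih η hη, map_smul]
      simp only [Pi.smul_apply, smul_eq_mul, hφ η hη]; ring
  rw [← tsum_iterate_eq_exp, Real.exp_eq_exp_ℝ, NormedSpace.exp_eq_tsum_div, ← tsum_mul_right]
  refine tsum_congr fun n => ?_
  rw [hit n η hη, mul_pow]; ring

/-- On the finite set S the constant 1 lies between two positive multiples of φ. The semigroup
preserves these inequalities and multiplies φ by exp(Λ t), so the prefactors disappear after taking
the logarithm and dividing by t. -/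
lemma tendsto_log_activityMGF {w μ : ℝ} (hw : 0 ≤ w) (hμ : 0 ≤ μ) (s : ℝ) {S : Set (Config L)}
    (hS : ∀ η ∈ S, ∀ k, flip η k ∈ S) {φ : Config L → ℝ} {Λ : ℝ} (hpos : ∀ η ∈ S, 0 < φ η)
    (hφ : ∀ η ∈ S, tiltedGenerator w μ s L φ η = Λ * φ η) {η : Config L} (hη : η ∈ S) :
    Tendsto (fun t : ℝ => Real.log (activityMGF w μ L η s t) / (L * t)) atTop (𝓝 (Λ / L)) := by
  set T := tiltedGenerator w μ s L with hTdef
  have hTpos : ∀ f : Config L → ℝ, (∀ η ∈ S, 0 ≤ f η) → ∀ η ∈ S,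
      0 ≤ T f η + (∑ _k : ZMod L, (μ + w * 2)) * f η := by
    intro f hf η hη
    rw [hTdef, tiltedGenerator_apply, Finset.sum_mul, ← Finset.sum_add_distrib]
    refine Finset.sum_nonneg fun k _ => ?_
    have o1 := occ_nonneg η k
    have o2 := occ_nonneg η (k + 1)
    have o3 := occ_le_one η k
    have o4 := occ_le_one η (k + 1)
    have h1 : 0 ≤ (μ + w * (occ η k + occ η (k + 1)) * Real.exp s) * f (flip η k) :=
      mul_nonneg (by positivity) (hf _ (hS η hη k))
    have h2 : 0 ≤ w * (2 - (occ η k + occ η (k + 1))) * f η :=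
      mul_nonneg (mul_nonneg hw (by linarith)) (hf η hη)
    linarith
  have hTloc : ∀ f g : Config L → ℝ, (∀ η ∈ S, f η = g η) → ∀ η ∈ S, T f η = T g η := by
    intro f g hfg η hη
    rw [hTdef, tiltedGenerator_apply, tiltedGenerator_apply]
    exact Finset.sum_congr rfl fun k _ => by rw [hfg η hη, hfg _ (hS η hη k)]
  obtain ⟨c, hc, hcφ⟩ : ∃ c : ℝ, 0 < c ∧ ∀ η ∈ S, φ η ≤ c := by
    refine ⟨1 + ∑ ξ, |φ ξ|, by positivity, fun ξ _ => ?_⟩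
    have := Finset.single_le_sum (f := fun ξ => |φ ξ|) (fun _ _ => abs_nonneg _)
      (Finset.mem_univ ξ)
    have := le_abs_self (φ ξ)
    linarith
  obtain ⟨C, hC, hCφ⟩ : ∃ C : ℝ, 0 < C ∧ ∀ η ∈ S, 1 ≤ C * φ η := by
    refine ⟨1 + ∑ ξ, |(φ ξ)⁻¹|, by positivity, fun ξ hξ => ?_⟩
    have h1 := Finset.single_le_sum (f := fun ξ => |(φ ξ)⁻¹|) (fun _ _ => abs_nonneg _)
      (Finset.mem_univ ξ)
    have h2 := le_abs_self (φ ξ)⁻¹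
    have h3 := hpos ξ hξ
    calc (1 : ℝ) = (φ ξ)⁻¹ * φ ξ := by field_simp
      _ ≤ _ := by gcongr; linarith
  have hbounds : ∀ t : ℝ, 0 ≤ t → c⁻¹ * φ η * Real.exp (Λ * t) ≤ activityMGF w μ L η s t ∧
      activityMGF w μ L η s t ≤ C * φ η * Real.exp (Λ * t) := by
    intro t ht
    rw [activityMGF_eq_tsum hw hμ s ht, tsum_iterate_eq_exp]
    set E := NormedSpace.exp (t • LinearMap.toContinuousLinearMap T)
    have hE : E φ η = Real.exp (Λ * t) * φ η := exp_eigen_on T hTloc hφ t hη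
    constructor
    · have := exp_nonneg_on T _ hTpos ht (f := (fun _ => 1) - c⁻¹ • φ) (fun ξ hξ => by
        have := hcφ ξ hξ
        simp only [Pi.sub_apply, Pi.smul_apply, smul_eq_mul, sub_nonneg]
        rw [inv_mul_le_iff₀ hc]; linarith) hη
      rw [map_sub, map_smul] at this
      change 0 ≤ E (fun _ => 1) η - c⁻¹ * E φ η at this
      rw [hE] at this; linarith
    · have := exp_nonneg_on T _ hTpos ht (f := C • φ - (fun _ => 1)) (fun ξ hξ => by
        have := hCφ ξ hξ
        simp only [Pi.sub_apply, Pi.smul_apply, smul_eq_mul, sub_nonneg]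
        linarith) hη
      rw [map_sub, map_smul] at this
      change 0 ≤ C * E φ η - E (fun _ => 1) η at this
      rw [hE] at this; linarith
  have hL : (0 : ℝ) < L := by exact_mod_cast NeZero.pos L
  have hφη := hpos η hη
  have hlim : ∀ d : ℝ, Tendsto (fun t : ℝ => (d + Λ * t) / (L * t)) atTop (𝓝 (Λ / L)) := by
    intro d
    have h1 : Tendsto (fun t : ℝ => d / L * t⁻¹ + Λ / L) atTop (𝓝 (d / L * 0 + Λ / L)) :=
      (tendsto_inv_atTop_zero.const_mul _).add_const _
    rw [mul_zero, zero_add] at h1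
    refine h1.congr' ?_
    filter_upwards [eventually_gt_atTop 0] with t ht
    field_simp
  refine tendsto_of_tendsto_of_tendsto_of_le_of_le' (hlim (Real.log (c⁻¹ * φ η)))
    (hlim (Real.log (C * φ η))) ?_ ?_
  · filter_upwards [eventually_gt_atTop 0] with t ht
    have hp : 0 < c⁻¹ * φ η := by positivity
    rw [← Real.log_exp (Λ * t), ← Real.log_mul hp.ne' (Real.exp_pos _).ne']
    gcongr
    exact (hbounds t ht.le).1
  · filter_upwards [eventually_gt_atTop 0] with t ht
    have hp : 0 < C * φ η := by positivity
    have hp' : 0 < c⁻¹ * φ η := by positivity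
    have hM : 0 < activityMGF w μ L η s t :=
      lt_of_lt_of_le (by positivity) (hbounds t ht.le).1
    rw [← Real.log_exp (Λ * t), ← Real.log_mul hp.ne' (Real.exp_pos _).ne']
    gcongr
    exact (hbounds t ht.le).2

end Semigroup

/-! ### Jordan–Wigner operators -/

section Majorana

variable {L : ℕ}

/-- The spin `±1` of an occupation number. -/
def spin (b : Bool) : ℂ := if b then -1 else 1

lemma spin_not (b : Bool) : spin (!b) = -spin b := by cases b <;> simp [spin]

lemma spin_mul_self (b : Bool) : spin b * spin b = 1 := by cases b <;> simp [spin]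

/-- The Jordan–Wigner sign of the sites `0, …, n - 1`. -/
noncomputable def jwSign (η : Config L) (n : ℕ) : ℂ := ∏ i ∈ Finset.range n, spin (η (i : ZMod L))

lemma jwSign_zero (η : Config L) : jwSign η 0 = 1 := by simp [jwSign]

lemma jwSign_succ (η : Config L) (n : ℕ) : jwSign η (n + 1) = jwSign η n * spin (η (n : ZMod L)) := by
  simp [jwSign, Finset.prod_range_succ]

lemma jwSign_mul_self (η : Config L) (n : ℕ) : jwSign η n * jwSign η n = 1 := by
  simp [jwSign, ← Finset.prod_mul_distrib, spin_mul_self]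

lemma jwSign_eq_or (η : Config L) (n : ℕ) : jwSign η n = 1 ∨ jwSign η n = -1 :=
  mul_self_eq_one_iff.mp (jwSign_mul_self η n)

lemma conj_jwSign (η : Config L) (n : ℕ) : (starRingEnd ℂ) (jwSign η n) = jwSign η n := by
  rcases jwSign_eq_or η n with h | h <;> simp [h]

/-- The configuration with the occupation number at `n` flipped. -/
def siteFlip (n : ℕ) (η : Config L) : Config L := Function.update η (n : ZMod L) (!η (n : ZMod L))

lemma natCast_zmod_inj {m n : ℕ} (hm : m < L) (hn : n < L) : (m : ZMod L) = n ↔ m = n := by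
  rw [ZMod.natCast_eq_natCast_iff', Nat.mod_eq_of_lt hm, Nat.mod_eq_of_lt hn]

lemma siteFlip_siteFlip (n : ℕ) (η : Config L) : siteFlip n (siteFlip n η) = η := by
  simp [siteFlip]

lemma siteFlip_comm (m n : ℕ) (η : Config L) :
    siteFlip m (siteFlip n η) = siteFlip n (siteFlip m η) := by
  by_cases h : (m : ZMod L) = n
  · simp [siteFlip, h]
  · simp only [siteFlip, Function.update_of_ne h, Function.update_of_ne (Ne.symm h)]
    exact (Function.update_comm h _ _ _).symm

lemma jwSign_siteFlip {m n : ℕ} (hm : m < L) (hn : n ≤ L) (η : Config L) :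
    jwSign (siteFlip m η) n = (if m < n then -1 else 1) * jwSign η n := by
  induction n with
  | zero => simp [jwSign_zero]
  | succ n ih =>
    rw [jwSign_succ, jwSign_succ, ih (by omega)]
    by_cases h : m = n
    · subst h
      simp [siteFlip, spin_not]
    · have h' : (n : ZMod L) ≠ m := by
        rw [Ne, natCast_zmod_inj (by omega) hm]; exact Ne.symm h
      rw [siteFlip, Function.update_of_ne h']
      have : m < n + 1 ↔ m < n := by omega
      simp only [this]; ring

lemma flip_eq_siteFlip (hL : 2 ≤ L) (n : ℕ) (η : Config L) :
    flip η (n : ZMod L) = siteFlip (n + 1) (siteFlip n η) := by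
  have : Fact (1 < L) := ⟨hL⟩
  have h1 : ((n : ZMod L) + 1) ≠ n := by simp
  ext j
  simp only [flip, siteFlip, Nat.cast_add, Nat.cast_one, Function.update_apply]
  by_cases h2 : j = (n : ZMod L) + 1
  · subst h2; simp
  · by_cases h3 : j = n
    · subst h3; simp
    · simp [h2, h3]

/-- The Majorana operators of the Jordan–Wigner transformation. -/
noncomputable def majorana (n j : ℕ) : Module.End ℂ (Config L → ℂ) where
  toFun v η := jwSign η j * v (siteFlip n η)
  map_add' u v := by ext η; simp [mul_add]
  map_smul' c v := by ext η; simp; ring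

lemma majorana_apply (n j : ℕ) (v : Config L → ℂ) (η : Config L) :
    majorana n j v η = jwSign η j * v (siteFlip n η) := rfl

lemma majorana_mul_apply {n i : ℕ} (hn : n < L) (hi : i ≤ L) (m j : ℕ) (v : Config L → ℂ)
    (η : Config L) : majorana n j (majorana m i v) η =
      (if n < i then -1 else 1) * (jwSign η j * jwSign η i) * v (siteFlip m (siteFlip n η)) := by
  rw [majorana_apply, majorana_apply, jwSign_siteFlip hn hi]; ring

/-- In Pauli notation X is a σᶻ string times σˣ. The string of Y also covers its own site, so Y
squares to -1 instead of 1 and all matrix entries stay real. -/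
noncomputable abbrev majX (n : ℕ) : Module.End ℂ (Config L → ℂ) := majorana n n
noncomputable abbrev majY (n : ℕ) : Module.End ℂ (Config L → ℂ) := majorana n (n + 1)

/-- The string of the operator at the larger site passes over the smaller site, but not conversely,
so exactly one of the two orders picks up a sign. -/
lemma majorana_anticomm {m n i j : ℕ} (hm : m < L) (hn : n < L) (hmn : m ≠ n)
    (hi : i = m ∨ i = m + 1) (hj : j = n ∨ j = n + 1) :
    (majorana m i * majorana n j + majorana n j * majorana m i : Module.End ℂ (Config L → ℂ))
      = 0 := by
  ext1 v; funext η
  simp only [LinearMap.add_apply, Module.End.mul_apply, Pi.add_apply, LinearMap.zero_apply,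
    Pi.zero_apply]
  rw [majorana_mul_apply hm (by omega), majorana_mul_apply hn (by omega), siteFlip_comm m n]
  rcases lt_or_gt_of_ne hmn with h | h
  · rw [if_pos (by omega), if_neg (by omega)]; ring
  · rw [if_neg (by omega), if_pos (by omega)]; ring

lemma majX_anticomm {m n : ℕ} (hm : m < L) (hn : n < L) :
    (majX m * majX n + majX n * majX m : Module.End ℂ (Config L → ℂ)) =
      (if m = n then (2 : ℂ) else 0) • 1 := by
  by_cases h : m = n
  · subst h
    ext1 v; funext η
    simp only [LinearMap.add_apply, Module.End.mul_apply, Pi.add_apply]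
    rw [majorana_mul_apply hm hm.le, jwSign_mul_self, siteFlip_siteFlip]
    simp; ring
  · rw [majorana_anticomm hm hn h (by simp) (by simp)]; simp [h]

lemma majY_anticomm {m n : ℕ} (hm : m < L) (hn : n < L) :
    (majY m * majY n + majY n * majY m : Module.End ℂ (Config L → ℂ)) =
      (if m = n then (-2 : ℂ) else 0) • 1 := by
  by_cases h : m = n
  · subst h
    ext1 v; funext η
    simp only [LinearMap.add_apply, Module.End.mul_apply, Pi.add_apply]
    rw [majorana_mul_apply hm hm, jwSign_mul_self, siteFlip_siteFlip]
    simp; ring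
  · rw [majorana_anticomm hm hn h (by simp) (by simp)]; simp [h]

/-- The vacuous `if` gives the relation the shape required by `fourierSum_anticomm` with c = 0. -/
lemma majX_majY_anticomm {m n : ℕ} (hm : m < L) (hn : n < L) :
    (majX m * majY n + majY n * majX m : Module.End ℂ (Config L → ℂ)) =
      (if m = n then (0 : ℂ) else 0) • 1 := by
  rw [ite_self, zero_smul]
  by_cases h : m = n
  · subst h
    ext1 v; funext η
    simp only [LinearMap.add_apply, Module.End.mul_apply, Pi.add_apply]
    rw [majorana_mul_apply hm hm, majorana_mul_apply hm hm.le, siteFlip_siteFlip]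
    simp; ring
  · exact majorana_anticomm hm hn h (by simp) (by simp)

/-- The discrete Fourier sum of a family of operators. -/
noncomputable def fourierSum (A : ℕ → Module.End ℂ (Config L → ℂ)) (z : ℂ) :
    Module.End ℂ (Config L → ℂ) := ∑ n ∈ Finset.range L, z ^ n • A n

lemma fourierSum_anticomm {A B : ℕ → Module.End ℂ (Config L → ℂ)} {c : ℂ}
    (h : ∀ m n, m < L → n < L → A m * B n + B n * A m = (if m = n then c else 0) • 1) (z w : ℂ) :
    fourierSum A z * fourierSum B w + fourierSum B w * fourierSum A z =
      (c * ∑ n ∈ Finset.range L, (z * w) ^ n) • 1 := by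
  unfold fourierSum
  rw [Finset.sum_mul_sum, Finset.sum_mul_sum, Finset.sum_comm (s := Finset.range L)
    (f := fun i j => (w ^ i • B i) * (z ^ j • A j)), ← Finset.sum_add_distrib, Finset.mul_sum,
    Finset.sum_smul]
  refine Finset.sum_congr rfl fun m hm => ?_
  rw [← Finset.sum_add_distrib, Finset.sum_eq_single m]
  · rw [smul_mul_smul_comm, smul_mul_smul_comm, mul_comm (w ^ m), ← smul_add,
      h m m (Finset.mem_range.mp hm) (Finset.mem_range.mp hm), if_pos rfl, smul_smul, ← mul_pow,
      mul_comm c]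
  · intro n hn hnm
    rw [smul_mul_smul_comm, smul_mul_smul_comm, mul_comm (w ^ n), ← smul_add,
      h m n (Finset.mem_range.mp hm) (Finset.mem_range.mp hn), if_neg (Ne.symm hnm)]
    simp
  · intro h'; exact absurd hm h'

end Majorana

/-! ### Antiperiodic momenta and their orthogonality -/

section Roots

/-- The `L`-th roots of `-1`. -/
noncomputable def negRoot (L j : ℕ) : ℂ := Complex.exp ((Real.pi * (2 * j + 1) / L : ℝ) * Complex.I)

variable {L : ℕ}

lemma negRoot_ne_zero (L j : ℕ) : negRoot L j ≠ 0 := Complex.exp_ne_zero _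

lemma conj_negRoot (L j : ℕ) : (starRingEnd ℂ) (negRoot L j) = (negRoot L j)⁻¹ := by
  rw [negRoot, ← Complex.exp_conj, ← Complex.exp_neg, map_mul, Complex.conj_ofReal,
    Complex.conj_I, mul_neg]

lemma negRoot_re (L j : ℕ) : (negRoot L j).re = Real.cos (Real.pi * (2 * j + 1) / L) :=
  Complex.exp_ofReal_mul_I_re _

lemma negRoot_im (L j : ℕ) : (negRoot L j).im = Real.sin (Real.pi * (2 * j + 1) / L) :=
  Complex.exp_ofReal_mul_I_im _

lemma negRoot_pow (hL : 0 < L) (j : ℕ) : negRoot L j ^ L = -1 := by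
  have hL' : (L : ℂ) ≠ 0 := by exact_mod_cast hL.ne'
  rw [negRoot, ← Complex.exp_nat_mul]
  have : (L : ℂ) * ((Real.pi * (2 * j + 1) / L : ℝ) * Complex.I) =
      Real.pi * Complex.I + j * (2 * Real.pi * Complex.I) := by
    push_cast; field_simp; ring
  rw [this, Complex.exp_add, Complex.exp_nat_mul_two_pi_mul_I, Complex.exp_pi_mul_I, mul_one]

lemma negRoot_eq (hL : 0 < L) (j : ℕ) : negRoot L j =
    negRoot L 0 * Complex.exp (2 * Real.pi * Complex.I / L) ^ j := by
  have hL' : (L : ℂ) ≠ 0 := by exact_mod_cast hL.ne'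
  rw [negRoot, negRoot, ← Complex.exp_nat_mul, ← Complex.exp_add]
  congr 1; push_cast; field_simp; ring

lemma negRoot_mul_rev (hL : 0 < L) {i j : ℕ} (h : i + j + 1 = L) :
    negRoot L i * negRoot L j = 1 := by
  have hL' : (L : ℂ) ≠ 0 := by exact_mod_cast hL.ne'
  rw [negRoot, negRoot, ← Complex.exp_add, ← Complex.exp_two_pi_mul_I]
  have h' : (L : ℂ) = i + j + 1 := by rw [← h]; push_cast; ring
  congr 1; push_cast; field_simp; rw [h']; ring

/-- Momentum reversal is the reflection j ↦ L - 1 - j. It has a fixed index only for odd L, where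
the root is -1. -/
lemma negRoot_rev {j : ℕ} (hj : j < L) : negRoot L (L - 1 - j) = (negRoot L j)⁻¹ :=
  eq_inv_of_mul_eq_one_left (negRoot_mul_rev (by omega) (by omega))

lemma negRoot_inj {i j : ℕ} (hi : i < L) (hj : j < L) (h : negRoot L i = negRoot L j) : i = j := by
  have hL : 0 < L := by omega
  rw [negRoot_eq hL i, negRoot_eq hL j] at h
  exact (Complex.isPrimitiveRoot_exp L hL.ne').pow_inj hi hj (mul_left_cancel₀ (negRoot_ne_zero L 0) h)

lemma sum_pow_eq_zero {w : ℂ} (hw : w ^ L = 1) (h : w ≠ 1) : ∑ n ∈ Finset.range L, w ^ n = 0 := by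
  rw [geom_sum_eq h, hw]; simp

lemma sum_negRoot_mul_pow {i j : ℕ} (hi : i < L) (hj : j < L) :
    ∑ n ∈ Finset.range L, (negRoot L i * negRoot L j) ^ n = if i + j + 1 = L then (L : ℂ) else 0 := by
  have hL : 0 < L := by omega
  split_ifs with h
  · rw [negRoot_mul_rev hL h]; simp
  · refine sum_pow_eq_zero (by rw [mul_pow, negRoot_pow hL, negRoot_pow hL]; norm_num) fun h1 => h ?_
    have := eq_inv_of_mul_eq_one_left h1
    rw [← negRoot_rev hj] at this
    have := negRoot_inj hi (by omega) this
    omega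

lemma sum_negRoot_inv_pow_mul_pow {m n : ℕ} (hm : m < L) (hn : n < L) :
    ∑ j ∈ Finset.range L, (negRoot L j)⁻¹ ^ n * negRoot L j ^ m = if m = n then (L : ℂ) else 0 := by
  have hL : 0 < L := by omega
  set ω := Complex.exp (2 * Real.pi * Complex.I / L) with hω
  have hprim : IsPrimitiveRoot ω L := Complex.isPrimitiveRoot_exp L hL.ne'
  have hω0 : ω ≠ 0 := Complex.exp_ne_zero _
  split_ifs with h
  · subst h
    simp [negRoot_ne_zero]
  · have h1 : ∀ j, (negRoot L j)⁻¹ ^ n * negRoot L j ^ m =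
        (negRoot L 0)⁻¹ ^ n * negRoot L 0 ^ m * (ω ^ m / ω ^ n) ^ j := by
      intro j
      rw [negRoot_eq hL j, ← hω]
      simp only [mul_inv, mul_pow, inv_pow, div_pow, ← pow_mul]
      rw [mul_comm j n, mul_comm j m]
      field_simp
    rw [Finset.sum_congr rfl fun j _ => h1 j, ← Finset.mul_sum, sum_pow_eq_zero, mul_zero]
    · rw [div_pow, ← pow_mul, ← pow_mul, mul_comm m, mul_comm n, pow_mul, pow_mul, hprim.pow_eq_one]
      simp
    · intro h2
      rw [div_eq_one_iff_eq (pow_ne_zero _ hω0)] at h2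
      exact h (hprim.pow_inj hm hn h2)

end Roots

/-! ### The symmetrized generator as a quadratic form -/

section QuadraticForm

variable {L : ℕ}

/-- Vectors supported on configurations with an even number of particles. -/
def IsEvenVec (v : Config L → ℂ) : Prop := ∀ η, jwSign η L = -1 → v η = 0

lemma natCast_self_siteFlip (η : Config L) : siteFlip L η = siteFlip 0 η := by simp [siteFlip]

lemma jwSign_siteFlip_self {m : ℕ} (hm : m < L) (η : Config L) :
    jwSign (siteFlip m η) L = -jwSign η L := by
  rw [jwSign_siteFlip hm le_rfl, if_pos hm]; ring

/-- Formally, site L is site 0 with a string around the whole torus. If flipping site 0 leads into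
the even sector, the original configuration is odd and that string equals -1. This sign is why roots
of -1 appear. -/
lemma majX_antiperiodic (hL : 0 < L) {v : Config L → ℂ} (hv : IsEvenVec v) :
    majX L v = -majX 0 v := by
  funext η
  rw [Pi.neg_apply, majorana_apply, majorana_apply, natCast_self_siteFlip, jwSign_zero]
  rcases jwSign_eq_or η L with h | h
  · rw [hv (siteFlip 0 η) (by rw [jwSign_siteFlip_self hL, h])]; simp
  · rw [h]; ring

lemma majY_antiperiodic (hL : 0 < L) {v : Config L → ℂ} (hv : IsEvenVec v) :
    majY L v = -majY 0 v := by
  funext η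
  rw [Pi.neg_apply, majorana_apply, majorana_apply, natCast_self_siteFlip, jwSign_succ, jwSign_succ,
    jwSign_zero, Nat.cast_zero, ZMod.natCast_self]
  rcases jwSign_eq_or η L with h | h
  · rw [hv (siteFlip 0 η) (by rw [jwSign_siteFlip_self hL, h])]; simp
  · rw [h]; ring

lemma fourierSum_apply (A : ℕ → Module.End ℂ (Config L → ℂ)) (z : ℂ) (v : Config L → ℂ) :
    fourierSum A z v = ∑ n ∈ Finset.range L, z ^ n • A n v := by
  simp [fourierSum, LinearMap.sum_apply]

lemma fourier_inversion {A : ℕ → Module.End ℂ (Config L → ℂ)} {v : Config L → ℂ} (hL : 0 < L)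
    (hA : A L v = -A 0 v) {n : ℕ} (hn : n ≤ L) :
    (L : ℂ) • A n v = ∑ j ∈ Finset.range L, (negRoot L j)⁻¹ ^ n • fourierSum A (negRoot L j) v := by
  have main : ∀ n < L, (L : ℂ) • A n v =
      ∑ j ∈ Finset.range L, (negRoot L j)⁻¹ ^ n • fourierSum A (negRoot L j) v := by
    intro n hn
    simp only [fourierSum_apply, Finset.smul_sum, smul_smul]
    rw [Finset.sum_comm]
    simp only [← Finset.sum_smul]
    rw [Finset.sum_eq_single n]
    · rw [sum_negRoot_inv_pow_mul_pow hn hn, if_pos rfl]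
    · intro m hm hmn
      rw [sum_negRoot_inv_pow_mul_pow (Finset.mem_range.mp hm) hn, if_neg hmn, zero_smul]
    · intro h; exact absurd (Finset.mem_range.mpr hn) h
  rcases hn.lt_or_eq with h | rfl
  · exact main n h
  · rw [hA, smul_neg, main 0 hL, ← Finset.sum_neg_distrib]
    refine Finset.sum_congr rfl fun j _ => ?_
    rw [inv_pow (negRoot n j) n, negRoot_pow hL]; simp

/-- Only B needs Fourier inversion, as it acts directly on v; antiperiodicity covers the index n + k
= L in the last term. -/
lemma sum_shift_eq_fourier {A B : ℕ → Module.End ℂ (Config L → ℂ)} {v : Config L → ℂ}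
    (hL : 0 < L) (hB : B L v = -B 0 v) {k : ℕ} (hk : k ≤ 1) :
    (L : ℂ) • ∑ n ∈ Finset.range L, A n (B (n + k) v) = ∑ j ∈ Finset.range L,
      (negRoot L j)⁻¹ ^ k • fourierSum A (negRoot L j)⁻¹ (fourierSum B (negRoot L j) v) := by
  have h1 : ∀ n ∈ Finset.range L, (L : ℂ) • A n (B (n + k) v) = ∑ j ∈ Finset.range L,
      (negRoot L j)⁻¹ ^ (n + k) • A n (fourierSum B (negRoot L j) v) := by
    intro n hn
    have := Finset.mem_range.mp hn
    rw [← map_smul, fourier_inversion hL hB (by omega), map_sum]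
    simp only [map_smul]
  rw [Finset.smul_sum, Finset.sum_congr rfl h1, Finset.sum_comm]
  refine Finset.sum_congr rfl fun j _ => ?_
  rw [fourierSum_apply A, Finset.smul_sum]
  refine Finset.sum_congr rfl fun n _ => ?_
  rw [smul_smul, pow_add, mul_comm]

lemma sum_rev {M : Type*} [AddCommMonoid M] (f : ℂ → M) :
    ∑ j ∈ Finset.range L, f (negRoot L j)⁻¹ = ∑ j ∈ Finset.range L, f (negRoot L j) := by
  rw [← Finset.sum_range_reflect]
  refine Finset.sum_congr rfl fun j hj => ?_
  rw [negRoot_rev (Finset.mem_range.mp hj), inv_inv]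

lemma sum_zmod_eq_sum_range [NeZero L] {M : Type*} [AddCommMonoid M] (f : ZMod L → M) :
    ∑ k, f k = ∑ n ∈ Finset.range L, f (n : ZMod L) := by
  symm
  refine Finset.sum_bij' (fun n _ => (n : ZMod L)) (fun k _ => k.val) ?_ ?_ ?_ ?_ ?_
  · simp
  · intro k _; simpa using ZMod.val_lt k
  · intro n hn; exact ZMod.val_cast_of_lt (Finset.mem_range.mp hn)
  · intro k _; simp
  · simp

lemma prod_zmod_eq_prod_range [NeZero L] {M : Type*} [CommMonoid M] (f : ZMod L → M) :
    ∏ k, f k = ∏ n ∈ Finset.range L, f (n : ZMod L) :=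
  sum_zmod_eq_sum_range (M := Additive M) f

/-- The symmetrized tilted generator, up to an additive constant. -/
noncomputable def symGenerator [NeZero L] (a b : ℝ) (v : Config L → ℂ) : Config L → ℂ := fun η =>
  ∑ k : ZMod L, ((if η k = η (k + 1) then (b : ℂ) else a) * v (flip η k)
    + 1 / 2 * spin (η k) * v η)

lemma majY_majX_succ (hL : 2 ≤ L) {n : ℕ} (hn : n < L) (v : Config L → ℂ) (η : Config L) :
    majY n (majX (n + 1) v) η = -v (flip η n) := by
  rw [majorana_mul_apply hn (by omega), if_pos (by omega), jwSign_mul_self, flip_eq_siteFlip hL]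
  ring

lemma majX_majY_succ (hL : 2 ≤ L) {n : ℕ} (hn : n < L) (v : Config L → ℂ) (η : Config L) :
    majX n (majY (n + 1) v) η = -(spin (η n) * spin (η (n + 1))) * v (flip η n) := by
  have : Fact (1 < L) := ⟨hL⟩
  have h1 : ((n : ZMod L) + 1) ≠ n := by simp
  rw [majorana_apply, majorana_apply, jwSign_succ, jwSign_succ, jwSign_siteFlip hn hn.le,
    if_neg (lt_irrefl n), flip_eq_siteFlip hL, siteFlip, Function.update_self, Nat.cast_add,
    Nat.cast_one, Function.update_of_ne h1, spin_not]
  linear_combination (-spin (η n) * spin (η (n + 1)) *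
    v (siteFlip (n + 1) (Function.update η n (!η n)))) * jwSign_mul_self η n

lemma majX_majY_self {n : ℕ} (hn : n < L) (v : Config L → ℂ) (η : Config L) :
    majX n (majY n v) η = -spin (η n) * v η := by
  rw [majorana_mul_apply hn (by omega), if_pos (by omega), jwSign_succ, siteFlip_siteFlip]
  linear_combination (-spin (η n) * v η) * jwSign_mul_self η n

/-- The flip amplitude is (a + b)/2 + (b - a)/2 times the product of the two spins: b for equal and
a for opposite occupation numbers. The three terms come from `majY_majX_succ`, `majX_majY_succ` and
`majX_majY_self`. -/
lemma symGenerator_eq [NeZero L] (hL : 2 ≤ L) (a b : ℝ) (v : Config L → ℂ) :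
    symGenerator a b v = (-((a + b) / 2 : ℂ)) • ∑ n ∈ Finset.range L, majY n (majX (n + 1) v)
      + (-((b - a) / 2 : ℂ)) • ∑ n ∈ Finset.range L, majX n (majY (n + 1) v)
      + (-(1 / 2 : ℂ)) • ∑ n ∈ Finset.range L, majX n (majY n v) := by
  funext η
  rw [symGenerator, sum_zmod_eq_sum_range]
  simp only [Finset.smul_sum, ← Finset.sum_add_distrib, Finset.sum_apply]
  refine Finset.sum_congr rfl fun n hn => ?_
  have hn := Finset.mem_range.mp hn
  simp only [Pi.add_apply, Pi.smul_apply, smul_eq_mul]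
  rw [majY_majX_succ hL hn, majX_majY_succ hL hn, majX_majY_self hn]
  cases η n <;> cases η ((n : ZMod L) + 1) <;> simp [spin] <;> ring

/-- The symbol of the quadratic form. -/
noncomputable def symbol (a b : ℝ) (z : ℂ) : ℂ := 1 - (a + b) * z⁻¹ + (b - a) * z

/-- The phase of the conjugate symbol. -/
noncomputable def phase (a b : ℝ) (z : ℂ) : ℂ := symbol a b z⁻¹ / ‖symbol a b z‖

lemma fourier_XX (z w : ℂ) : fourierSum (L := L) majX z * fourierSum majX w
    + fourierSum majX w * fourierSum majX z = (2 * ∑ n ∈ Finset.range L, (z * w) ^ n) • 1 :=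
  fourierSum_anticomm (fun _ _ => majX_anticomm) z w

lemma fourier_YY (z w : ℂ) : fourierSum (L := L) majY z * fourierSum majY w
    + fourierSum majY w * fourierSum majY z = (-2 * ∑ n ∈ Finset.range L, (z * w) ^ n) • 1 :=
  fourierSum_anticomm (fun _ _ => majY_anticomm) z w

lemma fourier_XY (z w : ℂ) : fourierSum (L := L) majX z * fourierSum majY w
    + fourierSum majY w * fourierSum majX z = 0 := by
  rw [fourierSum_anticomm (c := 0) (fun _ _ => majX_majY_anticomm) z w]; simp

/-- The XY terms are anticommuted into YX order and their momenta reversed, so that all three sums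
run over the same operators and their coefficients combine into the symbol. -/
lemma symGenerator_fourier [NeZero L] (hL : 2 ≤ L) (a b : ℝ) {v : Config L → ℂ}
    (hv : IsEvenVec v) : (L : ℂ) • symGenerator a b v = ∑ j ∈ Finset.range L,
      (1 / 2 * symbol a b (negRoot L j)) •
        fourierSum majY (negRoot L j)⁻¹ (fourierSum majX (negRoot L j) v) := by
  have hL0 : 0 < L := by omega
  have hXY : ∀ z w : ℂ, fourierSum (L := L) majX z (fourierSum majY w v) =
      -fourierSum majY w (fourierSum majX z v) := fun z w =>
    eq_neg_of_add_eq_zero_left (LinearMap.congr_fun (fourier_XY z w) v)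
  have h1 := sum_shift_eq_fourier (A := majY) (B := majX) hL0 (majX_antiperiodic hL0 hv) le_rfl
  have h2 := sum_shift_eq_fourier (A := majX) (B := majY) hL0 (majY_antiperiodic hL0 hv) le_rfl
  have h3 := sum_shift_eq_fourier (A := majX) (B := majY) hL0 (majY_antiperiodic hL0 hv) zero_le_one
  have r2 := sum_rev (L := L) fun z => z ^ 1 • -fourierSum majY z⁻¹ (fourierSum majX z v)
  have r3 := sum_rev (L := L) fun z => z ^ 0 • -fourierSum majY z⁻¹ (fourierSum majX z v)
  simp only [hXY] at h2 h3
  simp only [inv_inv] at r2 r3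
  rw [r2] at h2
  simp only [pow_zero] at h3 r3
  rw [r3] at h3
  rw [symGenerator_eq hL, smul_add, smul_add, smul_comm, h1, smul_comm, h2, smul_comm]
  simp only [add_zero] at h3
  rw [h3]
  simp only [Finset.smul_sum, ← Finset.sum_add_distrib]
  refine Finset.sum_congr rfl fun j _ => ?_
  simp only [smul_neg, smul_smul, ← neg_smul, ← add_smul]
  congr 1
  rw [symbol]; ring

end QuadraticForm

/-! ### Diagonalization and the variational principle -/

section Bogoliubov

variable {L : ℕ}

lemma conj_symbol (a b : ℝ) (j : ℕ) :
    (starRingEnd ℂ) (symbol a b (negRoot L j)) = symbol a b (negRoot L j)⁻¹ := by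
  simp [symbol, conj_negRoot]

lemma conj_symbol_inv (a b : ℝ) (j : ℕ) :
    (starRingEnd ℂ) (symbol a b (negRoot L j)⁻¹) = symbol a b (negRoot L j) := by
  rw [← conj_symbol, Complex.conj_conj]

lemma symbol_re (a b : ℝ) (j : ℕ) : (symbol a b (negRoot L j)).re =
    1 - 2 * a * Real.cos (Real.pi * (2 * j + 1) / L) := by
  simp [symbol, ← conj_negRoot, negRoot_re]; ring

lemma symbol_im (a b : ℝ) (j : ℕ) : (symbol a b (negRoot L j)).im =
    2 * b * Real.sin (Real.pi * (2 * j + 1) / L) := by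
  simp [symbol, ← conj_negRoot, negRoot_im]; ring

lemma norm_symbol_inv (a b : ℝ) (j : ℕ) :
    ‖symbol a b (negRoot L j)⁻¹‖ = ‖symbol a b (negRoot L j)‖ := by
  rw [← conj_symbol, RCLike.norm_conj]

lemma two_mul_add_one_eq_of_sin_eq_zero {j : ℕ} (hj : j < L)
    (h : Real.sin (Real.pi * (2 * j + 1) / L) = 0) : 2 * j + 1 = L := by
  have hL : (0 : ℝ) < L := by exact_mod_cast (by omega : 0 < L)
  have hj' : (j : ℝ) + 1 ≤ L := by exact_mod_cast hj
  rw [← Real.cos_pi_div_two_sub, Real.cos_eq_zero_iff] at h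
  obtain ⟨k, hk⟩ := h
  have h1 : (2 * (j : ℝ) + 1) = -k * L := by
    have hpi := Real.pi_ne_zero
    field_simp at hk
    linarith
  have h2 : (2 * (j : ℤ) + 1) = -k * L := by exact_mod_cast h1
  have h3 : (j : ℤ) + 1 ≤ L := by exact_mod_cast hj
  have hk : -k = 1 := by
    have hk1 : 0 < -k := by
      by_contra hc
      nlinarith
    have hk2 : -k < 2 := by
      by_contra hc
      nlinarith
    omega
  rw [hk] at h2
  omega

/-- For b > 0 the imaginary part vanishes only at momentum π, where the real part is 1 + 2a > 0.
Momentum 0, where the gap may close, is not an antiperiodic momentum. -/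
lemma symbol_ne_zero {a b : ℝ} (ha : 0 ≤ a) (hb : 0 < b) {j : ℕ} (hj : j < L) :
    symbol a b (negRoot L j) ≠ 0 := by
  intro h
  have hL : (0 : ℝ) < L := by exact_mod_cast (by omega : 0 < L)
  have h1 := symbol_im (L := L) a b j
  have h2 := symbol_re (L := L) a b j
  rw [h, Complex.zero_im] at h1
  rw [h, Complex.zero_re] at h2
  have h3 : Real.sin (Real.pi * (2 * j + 1) / L) = 0 := by
    rcases mul_eq_zero.mp h1.symm with h | h
    · linarith
    · exact h
  have h4 : (2 * (j : ℝ) + 1) = L := by exact_mod_cast two_mul_add_one_eq_of_sin_eq_zero hj h3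
  rw [h4, mul_div_assoc, div_self hL.ne', mul_one, Real.cos_pi] at h2
  linarith

lemma norm_symbol_ne_zero {a b : ℝ} (ha : 0 ≤ a) (hb : 0 < b) {j : ℕ} (hj : j < L) :
    (‖symbol a b (negRoot L j)‖ : ℂ) ≠ 0 := by
  simpa using symbol_ne_zero ha hb hj

lemma norm_mul_phase_inv {a b : ℝ} (ha : 0 ≤ a) (hb : 0 < b) {j : ℕ} (hj : j < L) :
    ‖symbol a b (negRoot L j)‖ * phase a b (negRoot L j)⁻¹ = symbol a b (negRoot L j) := by
  rw [phase, norm_symbol_inv, inv_inv, mul_div_cancel₀ _ (norm_symbol_ne_zero ha hb hj)]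

lemma phase_mul_phase_inv {a b : ℝ} (ha : 0 ≤ a) (hb : 0 < b) {j : ℕ} (hj : j < L) :
    phase a b (negRoot L j) * phase a b (negRoot L j)⁻¹ = 1 := by
  have h := norm_symbol_ne_zero ha hb hj
  rw [phase, phase, norm_symbol_inv, inv_inv, div_mul_div_comm, ← conj_symbol,
    mul_comm ((starRingEnd ℂ) _), Complex.mul_conj, Complex.normSq_eq_norm_sq]
  push_cast
  rw [← sq, div_self (pow_ne_zero 2 h)]

lemma phase_inv {a b : ℝ} (ha : 0 ≤ a) (hb : 0 < b) {j : ℕ} (hj : j < L) :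
    phase a b (negRoot L j)⁻¹ = (phase a b (negRoot L j))⁻¹ :=
  eq_inv_of_mul_eq_one_right (phase_mul_phase_inv ha hb hj)

lemma conj_phase (a b : ℝ) (j : ℕ) :
    (starRingEnd ℂ) (phase a b (negRoot L j)) = phase a b (negRoot L j)⁻¹ := by
  rw [phase, phase, map_div₀, conj_symbol_inv, Complex.conj_ofReal, norm_symbol_inv, inv_inv]

/-- The annihilation operators diagonalizing the symmetrized generator. -/
noncomputable def bogoliubov (a b : ℝ) (z : ℂ) : Module.End ℂ (Config L → ℂ) :=
  fourierSum majX z + phase a b z • fourierSum majY z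

/-- The adjoints of the operators `bogoliubov`. -/
noncomputable def bogoliubovAdj (a b : ℝ) (z : ℂ) : Module.End ℂ (Config L → ℂ) :=
  fourierSum majX z⁻¹ - phase a b z⁻¹ • fourierSum majY z⁻¹

/-- In the expanded product the XX and YY terms become constants once averaged with their momentum
reversals, and each of the two cross sums equals 2L times the generator, because modulus times
reversed phase is the symbol. The identity bounds the generator from above and describes the
maximizers. -/
lemma sum_bogoliubov [NeZero L] (hL : 2 ≤ L) {a b : ℝ} (ha : 0 ≤ a) (hb : 0 < b)
    {v : Config L → ℂ} (hv : IsEvenVec v) :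
    ∑ j ∈ Finset.range L, (‖symbol a b (negRoot L j)‖ : ℂ) •
      bogoliubovAdj a b (negRoot L j) (bogoliubov a b (negRoot L j) v) =
    (2 * L * ∑ j ∈ Finset.range L, (‖symbol a b (negRoot L j)‖ : ℂ)) • v
      - (4 * L : ℂ) • symGenerator a b v := by
  have hL0 : 0 < L := by omega
  have hXY : ∀ z w : ℂ, fourierSum (L := L) majX z (fourierSum majY w v) =
      -fourierSum majY w (fourierSum majX z v) := fun z w =>
    eq_neg_of_add_eq_zero_left (LinearMap.congr_fun (fourier_XY z w) v)
  have hone : ∀ j, ∑ n ∈ Finset.range L, ((negRoot L j)⁻¹ * negRoot L j) ^ n = (L : ℂ) := by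
    intro j; rw [inv_mul_cancel₀ (negRoot_ne_zero L j)]; simp
  have hXX : ∀ j, fourierSum (L := L) majX (negRoot L j)⁻¹ (fourierSum majX (negRoot L j) v) +
      fourierSum majX (negRoot L j) (fourierSum majX (negRoot L j)⁻¹ v) = (2 * L : ℂ) • v := by
    intro j
    have := LinearMap.congr_fun (fourier_XX (L := L) (negRoot L j)⁻¹ (negRoot L j)) v
    rwa [hone] at this
  have hYY : ∀ j, fourierSum (L := L) majY (negRoot L j)⁻¹ (fourierSum majY (negRoot L j) v) +
      fourierSum majY (negRoot L j) (fourierSum majY (negRoot L j)⁻¹ v) = (-2 * L : ℂ) • v := by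
    intro j
    have := LinearMap.congr_fun (fourier_YY (L := L) (negRoot L j)⁻¹ (negRoot L j)) v
    rwa [hone] at this
  have rX := sum_rev (L := L) fun z => (‖symbol a b z‖ : ℂ) •
    fourierSum majX z⁻¹ (fourierSum majX z v)
  have rY := sum_rev (L := L) fun z => (‖symbol a b z‖ : ℂ) •
    fourierSum majY z⁻¹ (fourierSum majY z v)
  have rC := sum_rev (L := L) fun z => (‖symbol a b z‖ * phase a b z⁻¹ : ℂ) •
    fourierSum majY z⁻¹ (fourierSum majX z v)
  simp only [inv_inv, norm_symbol_inv] at rX rY rC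
  have key : ∑ j ∈ Finset.range L, (‖symbol a b (negRoot L j)‖ : ℂ) •
      bogoliubovAdj a b (negRoot L j) (bogoliubov a b (negRoot L j) v) =
      (∑ j ∈ Finset.range L, (‖symbol a b (negRoot L j)‖ : ℂ) •
        fourierSum majX (negRoot L j)⁻¹ (fourierSum majX (negRoot L j) v))
      - (∑ j ∈ Finset.range L, (‖symbol a b (negRoot L j)‖ : ℂ) •
        fourierSum majY (negRoot L j)⁻¹ (fourierSum majY (negRoot L j) v))
      - (∑ j ∈ Finset.range L, (‖symbol a b (negRoot L j)‖ * phase a b (negRoot L j) : ℂ) •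
        fourierSum majY (negRoot L j) (fourierSum majX (negRoot L j)⁻¹ v))
      - (∑ j ∈ Finset.range L, (‖symbol a b (negRoot L j)‖ * phase a b (negRoot L j)⁻¹ : ℂ) •
        fourierSum majY (negRoot L j)⁻¹ (fourierSum majX (negRoot L j) v)) := by
    simp only [← Finset.sum_sub_distrib]
    refine Finset.sum_congr rfl fun j hj => ?_
    have hp := phase_mul_phase_inv ha hb (Finset.mem_range.mp hj)
    simp only [bogoliubovAdj, bogoliubov, LinearMap.sub_apply, LinearMap.add_apply,
      LinearMap.smul_apply, map_add, map_smul, hXY, smul_add, smul_sub, smul_smul, smul_neg]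
    rw [hp, mul_one]
    abel
  have hC : (∑ j ∈ Finset.range L, (‖symbol a b (negRoot L j)‖ * phase a b (negRoot L j)⁻¹ : ℂ) •
        fourierSum majY (negRoot L j)⁻¹ (fourierSum majX (negRoot L j) v)) =
      (2 * L : ℂ) • symGenerator a b v := by
    rw [mul_smul, symGenerator_fourier hL a b hv, Finset.smul_sum]
    refine Finset.sum_congr rfl fun j hj => ?_
    rw [norm_mul_phase_inv ha hb (Finset.mem_range.mp hj), smul_smul]
    congr 1; ring
  have hX : (2 : ℂ) • (∑ j ∈ Finset.range L, (‖symbol a b (negRoot L j)‖ : ℂ) •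
        fourierSum majX (negRoot L j)⁻¹ (fourierSum majX (negRoot L j) v)) =
      (2 * L * ∑ j ∈ Finset.range L, (‖symbol a b (negRoot L j)‖ : ℂ)) • v := by
    -- One of the two copies is replaced by its momentum reversal, which creates the anticommutator
    -- in `hXX`.
    rw [two_smul]; nth_rewrite 2 [← rX]
    rw [← Finset.sum_add_distrib, Finset.mul_sum, Finset.sum_smul]
    refine Finset.sum_congr rfl fun j hj => ?_
    rw [← smul_add, hXX, smul_smul, mul_comm]
  have hY : (2 : ℂ) • (∑ j ∈ Finset.range L, (‖symbol a b (negRoot L j)‖ : ℂ) •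
        fourierSum majY (negRoot L j)⁻¹ (fourierSum majY (negRoot L j) v)) =
      (-2 * L * ∑ j ∈ Finset.range L, (‖symbol a b (negRoot L j)‖ : ℂ)) • v := by
    rw [two_smul]; nth_rewrite 2 [← rY]
    rw [← Finset.sum_add_distrib, Finset.mul_sum, Finset.sum_smul]
    refine Finset.sum_congr rfl fun j hj => ?_
    rw [← smul_add, hYY, smul_smul, mul_comm]
  rw [key, rC, hC]
  generalize (∑ j ∈ Finset.range L, (‖symbol a b (negRoot L j)‖ : ℂ) •
        fourierSum majX (negRoot L j)⁻¹ (fourierSum majX (negRoot L j) v)) = TX at hX ⊢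
  generalize (∑ j ∈ Finset.range L, (‖symbol a b (negRoot L j)‖ : ℂ) •
        fourierSum majY (negRoot L j)⁻¹ (fourierSum majY (negRoot L j) v)) = TY at hY ⊢
  funext η
  have hX' := congrFun hX η
  have hY' := congrFun hY η
  simp only [Pi.smul_apply, Pi.sub_apply, smul_eq_mul] at hX' hY' ⊢
  linear_combination (1 / 2 : ℂ) * hX' - (1 / 2 : ℂ) * hY'

/-- The standard inner product on functions of the configuration. -/
noncomputable def pairing [NeZero L] (f g : Config L → ℂ) : ℂ := ∑ η, (starRingEnd ℂ) (f η) * g η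

lemma pairing_self [NeZero L] (f : Config L → ℂ) : pairing f f = ((∑ η, ‖f η‖ ^ 2 : ℝ) : ℂ) := by
  push_cast
  exact Finset.sum_congr rfl fun η _ => Complex.conj_mul' _

lemma pairing_add_right [NeZero L] (f g h : Config L → ℂ) :
    pairing f (g + h) = pairing f g + pairing f h := by
  simp [pairing, mul_add, Finset.sum_add_distrib]

lemma pairing_smul_right [NeZero L] (c : ℂ) (f g : Config L → ℂ) :
    pairing f (c • g) = c * pairing f g := by
  simp only [pairing, Finset.mul_sum, Pi.smul_apply, smul_eq_mul]
  exact Finset.sum_congr rfl fun _ _ => by ring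

lemma pairing_sum_right [NeZero L] {ι : Type*} (s : Finset ι) (f : Config L → ℂ)
    (g : ι → Config L → ℂ) : pairing f (∑ i ∈ s, g i) = ∑ i ∈ s, pairing f (g i) := by
  simp only [pairing, Finset.sum_apply, Finset.mul_sum]
  exact Finset.sum_comm

lemma pairing_comm [NeZero L] (f g : Config L → ℂ) :
    (starRingEnd ℂ) (pairing f g) = pairing g f := by
  simp [pairing, mul_comm]

/-- A site flip permutes the configurations and strings are real, so the adjoint differs only by the
sign of the string under the flip: X is self-adjoint and Y is anti-self-adjoint. -/
lemma pairing_majorana [NeZero L] {n i : ℕ} (hn : n < L) (hi : i ≤ L) (f g : Config L → ℂ) :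
    pairing f (majorana n i g) = (if n < i then -1 else 1) * pairing (majorana n i f) g := by
  unfold pairing
  have hperm : ∀ ξ, Function.Involutive.toPerm (siteFlip (L := L) n) (siteFlip_siteFlip n) ξ =
    siteFlip n ξ := fun _ => rfl
  rw [Finset.mul_sum]
  refine Fintype.sum_equiv (Function.Involutive.toPerm (siteFlip n) (siteFlip_siteFlip n)) _ _
    fun η => ?_
  simp only [hperm, majorana_apply, map_mul, conj_jwSign,
    siteFlip_siteFlip, jwSign_siteFlip hn hi]
  split_ifs <;> simp only [map_neg, map_one] <;> ring

lemma pairing_fourierSum [NeZero L] {A : ℕ → Module.End ℂ (Config L → ℂ)} {c : ℂ}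
    (hA : ∀ n < L, ∀ f g, pairing f (A n g) = c * pairing (A n f) g) (j : ℕ)
    (f g : Config L → ℂ) : pairing f (fourierSum A (negRoot L j)⁻¹ g) =
      c * pairing (fourierSum A (negRoot L j) f) g := by
  rw [← pairing_comm g, fourierSum_apply, fourierSum_apply, pairing_sum_right, pairing_sum_right,
    map_sum, Finset.mul_sum]
  refine Finset.sum_congr rfl fun n hn => ?_
  rw [pairing_smul_right, pairing_smul_right, hA n (Finset.mem_range.mp hn), map_mul, pairing_comm,
    map_pow, conj_negRoot]
  ring

lemma pairing_bogoliubovAdj [NeZero L] (a b : ℝ) (j : ℕ) (f g : Config L → ℂ) :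
    pairing f (bogoliubovAdj a b (negRoot L j) g) = pairing (bogoliubov a b (negRoot L j) f) g := by
  have hX := pairing_fourierSum (L := L) (A := majX) (c := 1) (fun n hn f g => by
    rw [pairing_majorana hn hn.le, if_neg (lt_irrefl n)]) j f g
  have hY := pairing_fourierSum (L := L) (A := majY) (c := -1) (fun n hn f g => by
    rw [pairing_majorana hn hn, if_pos (Nat.lt_succ_self n)]) j f g
  rw [← pairing_comm g, bogoliubov, bogoliubovAdj, LinearMap.sub_apply, LinearMap.add_apply,
    LinearMap.smul_apply, LinearMap.smul_apply, sub_eq_add_neg, ← neg_smul, pairing_add_right,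
    pairing_add_right, pairing_smul_right, pairing_smul_right, hX, hY, map_add, map_mul,
    pairing_comm, pairing_comm, conj_phase]
  ring

/-- The top of the spectrum of the symmetrized generator. -/
noncomputable def topEnergy (L : ℕ) (a b : ℝ) : ℝ :=
  1 / 2 * ∑ j ∈ Finset.range L, ‖symbol a b (negRoot L j)‖

lemma symGenerator_eq_of_annihilated [NeZero L] (hL : 2 ≤ L) {a b : ℝ} (ha : 0 ≤ a) (hb : 0 < b)
    {v : Config L → ℂ} (hv : IsEvenVec v)
    (h : ∀ j < L, bogoliubov a b (negRoot L j) v = 0) :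
    symGenerator a b v = (topEnergy L a b : ℂ) • v := by
  have h1 := sum_bogoliubov hL ha hb hv
  rw [Finset.sum_eq_zero fun j hj => by rw [h j (Finset.mem_range.mp hj), map_zero, smul_zero]]
    at h1
  have hL' : (L : ℂ) ≠ 0 := by exact_mod_cast (by omega : L ≠ 0)
  funext η
  have h2 := congrFun h1 η
  simp only [Pi.smul_apply, Pi.sub_apply, smul_eq_mul, Pi.zero_apply] at h2 ⊢
  refine mul_left_cancel₀ (mul_ne_zero (by norm_num : (4 : ℂ) ≠ 0) hL') ?_
  rw [topEnergy]; push_cast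
  linear_combination h2

lemma pairing_symGenerator [NeZero L] (hL : 2 ≤ L) {a b : ℝ} (ha : 0 ≤ a) (hb : 0 < b)
    {v : Config L → ℂ} (hv : IsEvenVec v) :
    4 * L * (pairing v (symGenerator a b v)).re = 4 * L * (topEnergy L a b * ∑ η, ‖v η‖ ^ 2)
      - ∑ j ∈ Finset.range L, ‖symbol a b (negRoot L j)‖ *
        ∑ η, ‖bogoliubov a b (negRoot L j) v η‖ ^ 2 := by
  have h1 := congrArg (pairing v) (sum_bogoliubov hL ha hb hv)
  rw [pairing_sum_right, sub_eq_add_neg, pairing_add_right, ← neg_smul, pairing_smul_right,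
    pairing_smul_right, pairing_self] at h1
  simp only [pairing_smul_right, pairing_bogoliubovAdj, pairing_self] at h1
  have h2 := congrArg Complex.re h1
  have e : (-(4 * L : ℂ) * pairing v (symGenerator a b v)).re =
      -(4 * L) * (pairing v (symGenerator a b v)).re := by
    rw [show (-(4 * L : ℂ)) = ((-(4 * L) : ℝ) : ℂ) by push_cast; ring, Complex.re_ofReal_mul]
  rw [Complex.add_re, e] at h2
  norm_cast at h2
  rw [topEnergy]
  push_cast at h2
  linear_combination h2

/-- A vector reaching the upper bound makes a sum of nonnegative terms vanish, and each weight is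
positive by `symbol_ne_zero`. -/
lemma annihilated_of_le_pairing [NeZero L] (hL : 2 ≤ L) {a b : ℝ} (ha : 0 ≤ a) (hb : 0 < b)
    {v : Config L → ℂ} (hv : IsEvenVec v)
    (h : topEnergy L a b * ∑ η, ‖v η‖ ^ 2 ≤ (pairing v (symGenerator a b v)).re) :
    ∀ j < L, bogoliubov a b (negRoot L j) v = 0 := by
  have h1 := pairing_symGenerator hL ha hb hv
  have h2 : ∑ j ∈ Finset.range L, ‖symbol a b (negRoot L j)‖ *
        ∑ η, ‖bogoliubov a b (negRoot L j) v η‖ ^ 2 ≤ 0 := by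
    have : (0 : ℝ) ≤ 4 * L := by positivity
    nlinarith [mul_le_mul_of_nonneg_left h this]
  have h3 := (Finset.sum_eq_zero_iff_of_nonneg fun j _ => by positivity).mp
    (le_antisymm h2 (Finset.sum_nonneg fun j _ => by positivity))
  intro j hj
  have h4 := (mul_eq_zero.mp (h3 j (Finset.mem_range.mpr hj))).resolve_left
    (norm_ne_zero_iff.mpr (symbol_ne_zero ha hb hj))
  have h5 := (Finset.sum_eq_zero_iff_of_nonneg fun η _ => by positivity).mp h4
  funext η
  simpa using h5 η (Finset.mem_univ η)

/-- Taking absolute values preserves the top eigenspace. -/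
lemma symGenerator_norm [NeZero L] (hL : 2 ≤ L) {a b : ℝ} (ha : 0 ≤ a) (hb : 0 < b)
    {v : Config L → ℂ} (hv : IsEvenVec v) (h : symGenerator a b v = (topEnergy L a b : ℂ) • v) :
    symGenerator a b (fun η => (‖v η‖ : ℂ)) =
      (topEnergy L a b : ℂ) • (fun η => (‖v η‖ : ℂ)) := by
  have hu : IsEvenVec (fun η => (‖v η‖ : ℂ)) := fun η hη => by simp [hv η hη]
  refine symGenerator_eq_of_annihilated hL ha hb hu (annihilated_of_le_pairing hL ha hb hu ?_)
  have h1 : (pairing v (symGenerator a b v)).re = topEnergy L a b * ∑ η, ‖v η‖ ^ 2 := by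
    rw [h, pairing_smul_right, pairing_self, ← Complex.ofReal_mul, Complex.ofReal_re]
  simp only [Complex.norm_real, norm_norm]
  rw [← h1]
  simp only [pairing, symGenerator, Complex.re_sum, Finset.mul_sum]
  -- The diagonal terms agree; in the off-diagonal ones the rates are nonnegative and the real part
  -- of a product is at most the product of the norms.
  refine Finset.sum_le_sum fun η _ => Finset.sum_le_sum fun k _ => ?_
  have hr : ∃ r : ℝ, 0 ≤ r ∧ (if η k = η (k + 1) then (b : ℂ) else a) = r := by
    split_ifs
    · exact ⟨b, hb.le, rfl⟩
    · exact ⟨a, ha, rfl⟩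
  obtain ⟨r, hr0, hr⟩ := hr
  have hs : ∃ t : ℝ, spin (η k) = t := by
    cases η k
    · exact ⟨1, by simp [spin]⟩
    · exact ⟨-1, by simp [spin]⟩
  obtain ⟨t, ht⟩ := hs
  rw [hr, ht]
  have e1 : (starRingEnd ℂ) (v η) * (r * v (flip η k) + 1 / 2 * t * v η) =
      r * ((starRingEnd ℂ) (v η) * v (flip η k)) + ((1 / 2 * t * ‖v η‖ ^ 2 : ℝ) : ℂ) := by
    have := Complex.conj_mul' (v η)
    push_cast
    linear_combination (1 / 2 * t : ℂ) * this
  have e2 : (starRingEnd ℂ) (‖v η‖ : ℂ) * (r * ‖v (flip η k)‖ + 1 / 2 * t * ‖v η‖) =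
      ((r * (‖v η‖ * ‖v (flip η k)‖) + 1 / 2 * t * ‖v η‖ ^ 2 : ℝ) : ℂ) := by
    rw [Complex.conj_ofReal]; push_cast; ring
  rw [e1, e2, Complex.add_re, Complex.re_ofReal_mul, Complex.ofReal_re, Complex.ofReal_re]
  have h3 : ((starRingEnd ℂ) (v η) * v (flip η k)).re ≤ ‖v η‖ * ‖v (flip η k)‖ :=
    (Complex.re_le_norm _).trans (by rw [norm_mul, RCLike.norm_conj])
  gcongr

end Bogoliubov

/-! ### Construction and positivity of the top eigenvector -/

section GroundState

variable {L : ℕ}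

lemma sum_negRoot_mul_phase {a b : ℝ} (ha : 0 ≤ a) (hb : 0 < b) {i j : ℕ} (hi : i < L)
    (hj : j < L) : (phase a b (negRoot L i) * phase a b (negRoot L j)) *
      ∑ n ∈ Finset.range L, (negRoot L i * negRoot L j) ^ n =
      ∑ n ∈ Finset.range L, (negRoot L i * negRoot L j) ^ n := by
  rw [sum_negRoot_mul_pow hi hj]
  split_ifs with h
  · have : j = L - 1 - i := by omega
    rw [this, negRoot_rev hi, phase_mul_phase_inv ha hb hi, one_mul]
  · simp

/-- The XX and YY anticommutators have opposite signs. They cancel because phases at opposite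
momenta multiply to 1, and for all other pairs the geometric sum vanishes. -/
lemma bogoliubov_anticomm {a b : ℝ} (ha : 0 ≤ a) (hb : 0 < b) {i j : ℕ} (hi : i < L)
    (hj : j < L) (v : Config L → ℂ) :
    bogoliubov a b (negRoot L i) (bogoliubov a b (negRoot L j) v) =
      -bogoliubov a b (negRoot L j) (bogoliubov a b (negRoot L i) v) := by
  set z := negRoot L i
  set w := negRoot L j
  funext η
  have h1 := congrFun (LinearMap.congr_fun (fourier_XX (L := L) z w) v) η
  have h2 := congrFun (LinearMap.congr_fun (fourier_YY (L := L) z w) v) η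
  have h3 := congrFun (LinearMap.congr_fun (fourier_XY (L := L) z w) v) η
  have h4 := congrFun (LinearMap.congr_fun (fourier_XY (L := L) w z) v) η
  have hS := sum_negRoot_mul_phase ha hb hi hj
  simp only [LinearMap.add_apply, LinearMap.smul_apply, Module.End.mul_apply, Pi.add_apply,
    Pi.smul_apply, smul_eq_mul, LinearMap.zero_apply, Pi.zero_apply, Module.End.one_apply]
    at h1 h2 h3 h4
  simp only [bogoliubov, LinearMap.add_apply, LinearMap.smul_apply, map_add, map_smul,
    Pi.add_apply, Pi.smul_apply, smul_eq_mul, Pi.neg_apply]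
  linear_combination h1 + phase a b z * phase a b w * h2 + phase a b w * h3 + phase a b z * h4
    - 2 * v η * hS

/-- The Fourier transformed particle annihilation operators. -/
noncomputable def annihilator (z : ℂ) : Module.End ℂ (Config L → ℂ) :=
  fourierSum majX z + fourierSum majY z

lemma annihilator_bogoliubov (a b : ℝ) (z w : ℂ) (v : Config L → ℂ) :
    annihilator z (bogoliubov a b w v) = -bogoliubov a b w (annihilator z v) +
      (2 * (1 - phase a b w) * ∑ n ∈ Finset.range L, (z * w) ^ n) • v := by
  funext η
  have h1 := congrFun (LinearMap.congr_fun (fourier_XX (L := L) z w) v) η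
  have h2 := congrFun (LinearMap.congr_fun (fourier_YY (L := L) z w) v) η
  have h3 := congrFun (LinearMap.congr_fun (fourier_XY (L := L) z w) v) η
  have h4 := congrFun (LinearMap.congr_fun (fourier_XY (L := L) w z) v) η
  simp only [LinearMap.add_apply, LinearMap.smul_apply, Module.End.mul_apply, Pi.add_apply,
    Pi.smul_apply, smul_eq_mul, LinearMap.zero_apply, Pi.zero_apply, Module.End.one_apply]
    at h1 h2 h3 h4
  simp only [annihilator, bogoliubov, LinearMap.add_apply, LinearMap.smul_apply, map_add, map_smul,
    Pi.add_apply, Pi.smul_apply, smul_eq_mul, Pi.neg_apply]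
  linear_combination h1 + phase a b w * h2 + phase a b w * h3 + h4

/-- The configuration without particles. -/
def emptyConfig (L : ℕ) : Config L := fun _ => false

lemma jwSign_emptyConfig (n : ℕ) : jwSign (emptyConfig L) n = 1 := by
  simp [jwSign, emptyConfig, spin]

lemma fourierSum_majX_apply (z : ℂ) (v : Config L → ℂ) (η : Config L) :
    fourierSum majX z v η = ∑ n ∈ Finset.range L, z ^ n * (jwSign η n * v (siteFlip n η)) := by
  rw [fourierSum_apply, Finset.sum_apply]; rfl

lemma fourierSum_majY_apply (z : ℂ) (v : Config L → ℂ) (η : Config L) :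
    fourierSum majY z v η =
      ∑ n ∈ Finset.range L, z ^ n * (jwSign η (n + 1) * v (siteFlip n η)) := by
  rw [fourierSum_apply, Finset.sum_apply]; rfl

lemma fourierSum_majY_emptyConfig (z : ℂ) (v : Config L → ℂ) :
    fourierSum majY z v (emptyConfig L) = fourierSum majX z v (emptyConfig L) := by
  rw [fourierSum_majX_apply, fourierSum_majY_apply]; simp only [jwSign_emptyConfig]

lemma bogoliubov_emptyConfig (a b : ℝ) (z : ℂ) (v : Config L → ℂ) :
    bogoliubov a b z v (emptyConfig L) =
      1 / 2 * (1 + phase a b z) * annihilator z v (emptyConfig L) := by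
  simp only [bogoliubov, annihilator, LinearMap.add_apply, LinearMap.smul_apply, Pi.add_apply,
    Pi.smul_apply, smul_eq_mul, fourierSum_majY_emptyConfig]
  ring

open Classical in
-- At each site the amplitude contains 1 + spin, hence vanishes unless the site is empty; the
-- flipped configuration then holds a particle and is not the vacuum.
lemma annihilator_vacuum (z : ℂ) :
    annihilator z (fun η : Config L => if η = emptyConfig L then 1 else 0) = 0 := by
  funext η
  rw [annihilator, LinearMap.add_apply, Pi.add_apply, fourierSum_majX_apply, fourierSum_majY_apply,
    ← Finset.sum_add_distrib]
  refine Finset.sum_eq_zero fun n _ => ?_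
  rw [jwSign_succ]
  cases h : η (n : ZMod L)
  · have : siteFlip n η ≠ emptyConfig L := fun h1 => by
      have := congrFun h1 (n : ZMod L)
      simp [siteFlip, emptyConfig, h] at this
    simp [this]
  · simp only [spin, if_true]; ring

lemma bogoliubov_parity (a b : ℝ) (z : ℂ) {σ : ℂ} {v : Config L → ℂ}
    (hv : ∀ η, jwSign η L = σ → v η = 0) (η : Config L) (hη : jwSign η L = -σ) :
    bogoliubov a b z v η = 0 := by
  have h : ∀ n ∈ Finset.range L, v (siteFlip n η) = 0 := fun n hn =>
    hv _ (by rw [jwSign_siteFlip_self (Finset.mem_range.mp hn), hη, neg_neg])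
  rw [bogoliubov, LinearMap.add_apply, LinearMap.smul_apply, Pi.add_apply, Pi.smul_apply,
    fourierSum_majX_apply, fourierSum_majY_apply,
    Finset.sum_eq_zero fun n hn => by rw [h n hn, mul_zero, mul_zero],
    Finset.sum_eq_zero fun n hn => by rw [h n hn, mul_zero, mul_zero]]
  simp

/-- Away from momentum π the symbol has nonzero imaginary part, so its phase is not real. The values
0, 1 and -1 are the ones to exclude when showing that the ground state does not vanish. -/
lemma phase_ne {a b : ℝ} (ha : 0 ≤ a) (hb : 0 < b) {k : ℕ} (hk : 2 * k + 1 < L) (r : ℝ) :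
    phase a b (negRoot L k) ≠ r := by
  intro h
  have hk' : k < L := by omega
  rw [phase, div_eq_iff (norm_symbol_ne_zero ha hb hk'), ← conj_symbol] at h
  have h1 := congrArg Complex.im h
  rw [← Complex.ofReal_mul, Complex.ofReal_im, Complex.conj_im, symbol_im, neg_eq_zero] at h1
  have h2 : Real.sin (Real.pi * (2 * k + 1) / L) = 0 :=
    (mul_eq_zero.mp h1).resolve_left (by positivity)
  have := two_mul_add_one_eq_of_sin_eq_zero hk' h2
  omega

lemma phase_eq_one {a b : ℝ} (ha : 0 ≤ a) {k : ℕ} (hk : 2 * k + 1 = L) :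
    phase a b (negRoot L k) = 1 := by
  have hL : (L : ℝ) ≠ 0 := by exact_mod_cast (by omega : L ≠ 0)
  have e : Real.pi * (2 * (k : ℝ) + 1) / L = Real.pi := by
    rw [show (2 * (k : ℝ) + 1) = L by exact_mod_cast hk]; field_simp
  have h : symbol a b (negRoot L k) = ((1 + 2 * a : ℝ) : ℂ) := by
    apply Complex.ext
    · rw [symbol_re, e, Real.cos_pi, Complex.ofReal_re]; ring
    · rw [symbol_im, e, Real.sin_pi, Complex.ofReal_im]; ring
  have h2 : (0 : ℝ) < 1 + 2 * a := by positivity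
  rw [phase, ← conj_symbol, h, Complex.conj_ofReal, Complex.norm_real, Real.norm_eq_abs,
    abs_of_pos h2, div_self (by exact_mod_cast h2.ne')]

/-- Opposite momenta are treated in pairs, as in the BCS construction: applying both B's of a pair
produces a vector killed by both, since each squares to 0, and unaffected pairs keep their bare
annihilators. The amplitude at the empty configuration is tracked because it certifies that the
vector is nonzero. -/
lemma exists_partial_groundState {a b : ℝ} (ha : 0 ≤ a) (hb : 0 < b) (k : ℕ) (hk : 2 * k ≤ L) :
    ∃ ψ : Config L → ℂ, IsEvenVec ψ ∧ ψ (emptyConfig L) ≠ 0 ∧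
      (∀ i < L, (i < k ∨ L - 1 - i < k) → bogoliubov a b (negRoot L i) ψ = 0) ∧
      (∀ i < L, k ≤ i → k ≤ L - 1 - i → annihilator (negRoot L i) ψ = 0) := by
  classical
  induction k with
  | zero =>
    refine ⟨fun η => if η = emptyConfig L then 1 else 0, fun η hη => ?_, by simp, by simp,
      fun i _ _ _ => annihilator_vacuum _⟩
    by_cases h : η = emptyConfig L
    · rw [h, jwSign_emptyConfig] at hη; norm_num at hη
    · simp [h]
  | succ k ih =>
    obtain ⟨ψ, hev, hne, hbog, hann⟩ := ih (by omega)
    have hk' : k < L := by omega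
    have hr' : L - 1 - k < L := by omega
    refine ⟨bogoliubov a b (negRoot L (L - 1 - k)) (bogoliubov a b (negRoot L k) ψ), ?_, ?_, ?_, ?_⟩
    · have h1 := bogoliubov_parity a b (negRoot L k) hev
      rw [neg_neg] at h1
      exact bogoliubov_parity a b _ h1
    -- The amplitude is multiplied by (1/2)(1 + p⁻¹) · 2(1 - p) · L with p the phase, which is
    -- nonzero because p ≠ ±1.
    · rw [bogoliubov_emptyConfig, annihilator_bogoliubov, hann _ hr' (by omega) (by omega), map_zero,
        neg_zero, zero_add, sum_negRoot_mul_pow hr' hk', if_pos (by omega), negRoot_rev hk',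
        phase_inv ha hb hk', Pi.smul_apply, smul_eq_mul]
      have hp1 := phase_ne ha hb (by omega : 2 * k + 1 < L) 1
      have hp2 := phase_ne ha hb (by omega : 2 * k + 1 < L) (-1)
      have hp0 := phase_ne ha hb (by omega : 2 * k + 1 < L) 0
      push_cast at hp1 hp2 hp0
      have hL' : (L : ℂ) ≠ 0 := by exact_mod_cast (by omega : L ≠ 0)
      have h1 : 1 + (phase a b (negRoot L k))⁻¹ ≠ 0 := by
        intro h
        apply hp2
        field_simp at h
        linear_combination h
      have h2 : 1 - phase a b (negRoot L k) ≠ 0 := fun h => hp1 (by linear_combination -h)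
      refine mul_ne_zero (mul_ne_zero (by norm_num) h1) (mul_ne_zero (mul_ne_zero
        (mul_ne_zero two_ne_zero h2) hL') hne)
    · intro i hi hik
      have hsq : ∀ u, bogoliubov a b (negRoot L i) (bogoliubov a b (negRoot L i) u) = 0 :=
        fun u => self_eq_neg.mp (bogoliubov_anticomm ha hb hi hi u)
      by_cases h : i < k ∨ L - 1 - i < k
      · rw [bogoliubov_anticomm ha hb hi hr', bogoliubov_anticomm ha hb hi hk', hbog i hi h]; simp
      · have h2 : i = k ∨ i = L - 1 - k := by omega
        rcases h2 with rfl | rfl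
        · rw [bogoliubov_anticomm ha hb hi hr', hsq]; simp
        · exact hsq _
    · intro i hi h1 h2
      rw [annihilator_bogoliubov, annihilator_bogoliubov, hann i hi (by omega) (by omega),
        sum_negRoot_mul_pow hi hr', sum_negRoot_mul_pow hi hk', if_neg (by omega),
        if_neg (by omega)]
      simp

lemma exists_groundState {a b : ℝ} (ha : 0 ≤ a) (hb : 0 < b) :
    ∃ ψ : Config L → ℂ, IsEvenVec ψ ∧ ψ (emptyConfig L) ≠ 0 ∧
      ∀ i < L, bogoliubov a b (negRoot L i) ψ = 0 := by
  obtain ⟨ψ, h1, h2, h3, h4⟩ := exists_partial_groundState (L := L) ha hb (L / 2) (by omega)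
  refine ⟨ψ, h1, h2, fun i hi => ?_⟩
  by_cases h : i < L / 2 ∨ L - 1 - i < L / 2
  · exact h3 i hi h
  -- Only the self-paired momentum π of odd L remains; its phase is 1, so B is the bare annihilator.
  · have := h4 i hi (by omega) (by omega)
    rwa [annihilator, ← one_smul ℂ (fourierSum majY (negRoot L i)),
      ← phase_eq_one (b := b) ha (by omega : 2 * i + 1 = L)] at this

/-- Sweeping along the torus, a flip moves each particle to the next site or annihilates it with the
one there. Only the last site can remain occupied, which even parity forbids. -/
lemma emptyConfig_of_flip_invariant [NeZero L] (hL : 2 ≤ L) {Z : Config L → Prop}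
    (hZ : ∀ η, Z η → ∀ k, Z (flip η k)) {η : Config L} (hη : Z η) (hev : jwSign η L = 1) :
    Z (emptyConfig L) := by
  have key : ∀ n, n < L → ∃ ξ : Config L, Z ξ ∧ jwSign ξ L = 1 ∧
      ∀ j < n, ξ (j : ZMod L) = false := by
    intro n
    induction n with
    | zero => exact fun _ => ⟨η, hη, hev, by simp⟩
    | succ n ih =>
      intro hn
      obtain ⟨ξ, h1, h2, h3⟩ := ih (by omega)
      cases h : ξ (n : ZMod L)
      · refine ⟨ξ, h1, h2, fun j hj => ?_⟩
        rcases Nat.lt_succ_iff_lt_or_eq.mp hj with hj | rfl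
        · exact h3 j hj
        · exact h
      · refine ⟨flip ξ n, hZ _ h1 _, ?_, fun j hj => ?_⟩
        · rw [flip_eq_siteFlip hL, jwSign_siteFlip_self hn, jwSign_siteFlip_self (by omega), h2]
          norm_num
        · have hj1 : (j : ZMod L) ≠ ((n + 1 : ℕ) : ZMod L) := by
            rw [Ne, natCast_zmod_inj (by omega) hn]; omega
          rw [flip_eq_siteFlip hL, siteFlip, Function.update_of_ne hj1, siteFlip]
          rcases Nat.lt_succ_iff_lt_or_eq.mp hj with hj | rfl
          · have hj2 : (j : ZMod L) ≠ (n : ZMod L) := by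
              rw [Ne, natCast_zmod_inj (by omega) (by omega)]; omega
            rw [Function.update_of_ne hj2, h3 j hj]
          · simp [h]
  obtain ⟨ξ, h1, h2, h3⟩ := key (L - 1) (by omega)
  have hlast : ξ ((L - 1 : ℕ) : ZMod L) = false := by
    have h4 : jwSign ξ (L - 1 + 1) = 1 := by rwa [Nat.sub_add_cancel (by omega)]
    rw [jwSign_succ, jwSign, Finset.prod_eq_one fun j hj => by
      rw [h3 j (Finset.mem_range.mp hj)]; rfl] at h4
    cases h : ξ ((L - 1 : ℕ) : ZMod L)
    · rfl
    · rw [h] at h4; norm_num [spin] at h4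
  have : ξ = emptyConfig L := by
    funext k
    have hk := ZMod.val_lt k
    rw [← ZMod.natCast_zmod_val k]
    by_cases h : k.val = L - 1
    · rw [h]; exact hlast
    · exact h3 _ (by omega)
  rwa [← this]

/-- The symmetrized generator has a top eigenfunction which is positive in the even sector. -/
lemma exists_pos_symmetric_eigenfunction [NeZero L] (hL : 2 ≤ L) {a b : ℝ} (ha : 0 < a)
    (hb : 0 < b) : ∃ φ : Config L → ℝ, (∀ η, jwSign η L = 1 → 0 < φ η) ∧
      ∀ η, ∑ k : ZMod L, ((if η k = η (k + 1) then b else a) * φ (flip η k)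
        + (1 / 2 - occ η k) * φ η) = topEnergy L a b * φ η := by
  obtain ⟨ψ, hev, hne, hψ⟩ := exists_groundState (L := L) ha.le hb
  have h1 := symGenerator_norm hL ha.le hb hev (symGenerator_eq_of_annihilated hL ha.le hb hev hψ)
  have h2 : ∀ η, ∑ k : ZMod L, ((if η k = η (k + 1) then b else a) * ‖ψ (flip η k)‖
        + (1 / 2 - occ η k) * ‖ψ η‖) = topEnergy L a b * ‖ψ η‖ := by
    intro η
    have h3 := congrFun h1 η
    rw [symGenerator, Pi.smul_apply, smul_eq_mul] at h3
    apply Complex.ofReal_injective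
    push_cast
    rw [← h3]
    refine Finset.sum_congr rfl fun k _ => ?_
    congr 1
    · split_ifs <;> rfl
    · unfold occ spin
      split_ifs <;> push_cast <;> ring
  refine ⟨fun η => ‖ψ η‖, fun η hη => ?_, h2⟩
  rw [norm_pos_iff]
  intro h0
  -- Zeros propagate: where the nonnegative eigenfunction vanishes, the eigenvalue equation is a
  -- vanishing sum with positive rates, so it vanishes at every flipped configuration and finally at
  -- the empty one.
  refine hne (emptyConfig_of_flip_invariant hL (Z := fun η => ψ η = 0) (fun ξ hξ k => ?_) h0 hη)
  have h3 := h2 ξ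
  simp only [hξ, norm_zero, mul_zero, add_zero] at h3
  have hr : 0 < (if ξ k = ξ (k + 1) then b else a) := by split_ifs <;> assumption
  have h4 := (Finset.sum_eq_zero_iff_of_nonneg fun k _ => by
    split_ifs <;> positivity).mp h3 k (Finset.mem_univ k)
  rw [mul_eq_zero, norm_eq_zero] at h4
  exact h4.resolve_left hr.ne'

end GroundState

/-! ### Explicit cumulant generating function and mean activity -/

section CumulantGeneratingFunction

variable {L : ℕ}

lemma even_particleNumber_iff [NeZero L] (η : Config L) :
    Even (particleNumber η) ↔ jwSign η L = 1 := by
  have h : jwSign η L = (-1) ^ particleNumber η := by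
    rw [jwSign, ← prod_zmod_eq_prod_range fun k => spin (η k), particleNumber,
      ← Finset.prod_pow_eq_pow_sum]
    refine Finset.prod_congr rfl fun k _ => ?_
    cases η k <;> simp [spin]
  rw [h]
  refine ⟨fun h => h.neg_one_pow, fun h => ?_⟩
  by_contra hodd
  rw [(Nat.not_even_iff_odd.mp hodd).neg_one_pow] at h
  norm_num at h

lemma even_particleNumber_flip [NeZero L] (hL : 2 ≤ L) {η : Config L}
    (hη : Even (particleNumber η)) (k : ZMod L) : Even (particleNumber (flip η k)) := by
  rw [even_particleNumber_iff] at *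
  have hp : ∀ m : ZMod L, ∀ ξ : Config L, jwSign (siteFlip m.val ξ) L = -jwSign ξ L :=
    fun m ξ => jwSign_siteFlip_self (ZMod.val_lt m) ξ
  have h1 : siteFlip (k.val + 1) (siteFlip k.val η) = siteFlip (k + 1).val (siteFlip k.val η) := by
    simp [siteFlip]
  rw [← ZMod.natCast_zmod_val k, flip_eq_siteFlip hL, h1, hp, hp, neg_neg, hη]

/-- A product weight with factor `g` for every particle. -/
noncomputable def particleWeight [NeZero L] (g : ℝ) (η : Config L) : ℝ :=
  ∏ k, if η k then g else 1

lemma particleWeight_pos [NeZero L] {g : ℝ} (hg : 0 < g) (η : Config L) :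
    0 < particleWeight g η :=
  Finset.prod_pos fun k _ => by split_ifs <;> positivity

lemma particleWeight_update [NeZero L] (g : ℝ) (η : Config L) (k : ZMod L) (b : Bool) :
    particleWeight g (Function.update η k b) * (if η k then g else 1) =
      particleWeight g η * (if b then g else 1) := by
  unfold particleWeight
  rw [← Finset.mul_prod_erase _ _ (Finset.mem_univ k),
    ← Finset.mul_prod_erase _ (fun i => if η i then g else 1) (Finset.mem_univ k),
    Function.update_self, Finset.prod_congr rfl fun i hi => by
      rw [Function.update_of_ne (Finset.ne_of_mem_erase hi)]]
  ring

lemma particleWeight_flip [NeZero L] (hL : 2 ≤ L) (g : ℝ) (η : Config L) (k : ZMod L) :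
    particleWeight g (flip η k) * ((if η k then g else 1) * (if η (k + 1) then g else 1)) =
      particleWeight g η * ((if !η k then g else 1) * (if !η (k + 1) then g else 1)) := by
  have : Fact (1 < L) := ⟨hL⟩
  have h0 : k + 1 ≠ k := by simp
  have h : flip η k = Function.update (Function.update η k (!η k)) (k + 1) (!η (k + 1)) := by
    funext j
    simp only [flip, Function.update_apply]
    by_cases h2 : j = k + 1
    · subst h2; simp
    · by_cases h3 : j = k
      · subst h3; simp
      · simp [h2, h3]
  have h1 := particleWeight_update g η k (!η k)
  have h2 := particleWeight_update g (Function.update η k (!η k)) (k + 1) (!η (k + 1))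
  rw [Function.update_of_ne h0] at h2
  rw [h]
  linear_combination (if η k then g else 1) * h2 + (if !η (k + 1) then g else 1) * h1

/-- The tilted generator has a positive eigenfunction in the even sector. -/
lemma exists_pos_eigenfunction [NeZero L] (hL : 2 ≤ L) {μ : ℝ} (hμ : 0 < μ) (s : ℝ) :
    ∃ φ : Config L → ℝ, (∀ η, Even (particleNumber η) → 0 < φ η) ∧
      ∀ η, tiltedGenerator (1 / 2) μ s L φ η = (topEnergy L (μ + Real.exp s / 2)
        (Real.sqrt (μ * (μ + Real.exp s))) - L * (μ + 1 / 2)) * φ η := by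
  set x := Real.exp s
  have hx : 0 < x := Real.exp_pos s
  set a := μ + x / 2
  set b := Real.sqrt (μ * (μ + x)) with hbdef
  have hb2 : b ^ 2 = μ * (μ + x) := Real.sq_sqrt (by positivity)
  have hb : 0 < b := Real.sqrt_pos.mpr (by positivity)
  -- The choice g² = b/μ equalizes the rates: creation becomes μ g² = b and annihilation (μ + x)/g²
  -- = b, while hops keep their weight and rate a.
  set g := Real.sqrt (b / μ)
  have hg : 0 < g := Real.sqrt_pos.mpr (by positivity)
  have hg2 : g ^ 2 = b / μ := Real.sq_sqrt (by positivity)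
  obtain ⟨φ, hpos, hφ⟩ := exists_pos_symmetric_eigenfunction hL (by positivity : 0 < a) hb
  refine ⟨fun η => particleWeight g η * φ η, fun η hη =>
    mul_pos (particleWeight_pos hg η) (hpos η ((even_particleNumber_iff η).mp hη)), fun η => ?_⟩
  have hrate : ∀ k, (μ + 1 / 2 * (occ η k + occ η (k + 1)) * x) * particleWeight g (flip η k) =
      (if η k = η (k + 1) then b else a) * particleWeight g η := by
    intro k
    have hf := particleWeight_flip hL g η k
    unfold occ
    cases h1 : η k <;> cases h2 : η (k + 1) <;> simp only [h1, h2] at hf <;>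
      simp only [Bool.not_true, Bool.not_false, if_true, Bool.false_eq_true, if_false] at hf <;>
      simp only [Bool.false_eq_true, if_true, if_false, reduceCtorEq]
    · have : μ * g ^ 2 = b := by rw [hg2]; field_simp
      linear_combination μ * hf + particleWeight g η * this
    · have h3 : particleWeight g (flip η k) = particleWeight g η :=
        mul_right_cancel₀ hg.ne' (by linear_combination hf)
      rw [h3]; ring
    · have h3 : particleWeight g (flip η k) = particleWeight g η :=
        mul_right_cancel₀ hg.ne' (by linear_combination hf)
      rw [h3]; ring
    · have h3 : particleWeight g η = particleWeight g (flip η k) * g ^ 2 := by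
        linear_combination -hf
      rw [h3, hg2]
      field_simp
      linear_combination -2 * particleWeight g (flip η k) * hb2
  -- By translation, half the occupation of both ends of a bond may be replaced by that of its left
  -- end in the summed holding rate.
  have hocc : ∑ k : ZMod L, occ η (k + 1) = ∑ k, occ η k :=
    Equiv.sum_comp (Equiv.addRight (1 : ZMod L)) fun k => occ η k
  have h1 : tiltedGenerator (1 / 2) μ s L (fun η => particleWeight g η * φ η) η =
      particleWeight g η * ∑ k : ZMod L, ((if η k = η (k + 1) then b else a) * φ (flip η k)
        + (1 / 2 - occ η k) * φ η) - L * (μ + 1 / 2) * (particleWeight g η * φ η) := by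
    have hc : (L : ℝ) * (μ + 1 / 2) * (particleWeight g η * φ η) =
        ∑ _k : ZMod L, (μ + 1 / 2) * (particleWeight g η * φ η) := by
      rw [Finset.sum_const, Finset.card_univ, ZMod.card, nsmul_eq_mul]; ring
    have h0 : ∑ k : ZMod L, (1 / 2 * (occ η k - occ η (k + 1))) * (particleWeight g η * φ η) = 0 := by
      rw [← Finset.sum_mul, ← Finset.mul_sum, Finset.sum_sub_distrib, hocc]; ring
    rw [tiltedGenerator_apply, hc, Finset.mul_sum, ← Finset.sum_sub_distrib, ← sub_eq_zero,
      ← Finset.sum_sub_distrib, ← h0]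
    refine Finset.sum_congr rfl fun k _ => ?_
    linear_combination φ (flip η k) * hrate k
  rw [h1, hφ]; ring

/-- The dispersion relation, squared, as a function of `x = exp s` and the momentum `q`. -/
noncomputable def dispersionSq (μ x q : ℝ) : ℝ :=
  (1 - (2 * μ + x) * Real.cos q) ^ 2 + 4 * (μ * (μ + x)) * Real.sin q ^ 2

/-- The allowed momenta of the even sector. -/
noncomputable def momentum (L j : ℕ) : ℝ := Real.pi * (2 * j + 1) / L

lemma norm_symbol_eq {μ x : ℝ} (hμ : 0 ≤ μ) (hx : 0 ≤ x) (j : ℕ) :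
    ‖symbol (μ + x / 2) (Real.sqrt (μ * (μ + x))) (negRoot L j)‖ =
      Real.sqrt (dispersionSq μ x (momentum L j)) := by
  rw [← Real.sqrt_sq (norm_nonneg _), Complex.sq_norm, Complex.normSq_apply, symbol_re, symbol_im,
    dispersionSq, momentum]
  congr 1
  have := Real.sq_sqrt (by positivity : 0 ≤ μ * (μ + x))
  linear_combination 4 * Real.sin (Real.pi * (2 * j + 1) / L) ^ 2 * this

lemma dispersionSq_pos {μ x : ℝ} (hμ : 0 < μ) (hx : 0 ≤ x) {j : ℕ} (hj : j < L) :
    0 < dispersionSq μ x (momentum L j) := by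
  rw [← Real.sqrt_pos, ← norm_symbol_eq hμ.le hx, norm_pos_iff]
  exact symbol_ne_zero (by positivity) (Real.sqrt_pos.mpr (by positivity)) hj

/-- The limiting cumulant generating function of the activity. -/
noncomputable def activityCGF (μ : ℝ) (L : ℕ) (s : ℝ) : ℝ :=
  1 / (2 * L) * ∑ j ∈ Finset.range L, Real.sqrt (dispersionSq μ (Real.exp s) (momentum L j))
    - (μ + 1 / 2)

lemma isEvenCGF_activityCGF [NeZero L] (hL : 2 ≤ L) {μ : ℝ} (hμ : 0 < μ) :
    IsEvenCGF (1 / 2) μ L (activityCGF μ L) := by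
  intro η hη s
  have hw : (0 : ℝ) ≤ 1 / 2 := by norm_num
  refine ⟨fun t ht => summable_activityMGF hw hμ.le s ht.le _, ?_⟩
  obtain ⟨φ, hpos, hφ⟩ := exists_pos_eigenfunction hL hμ s
  have h := tendsto_log_activityMGF hw hμ.le s
    (S := {η : Config L | Even (particleNumber η)}) (fun η hη k => even_particleNumber_flip hL hη k)
    hpos (fun η _ => hφ η) hη
  convert h using 2
  have hL' : (L : ℝ) ≠ 0 := by exact_mod_cast (by omega : L ≠ 0)
  simp only [activityCGF, topEnergy, norm_symbol_eq hμ.le (Real.exp_pos s).le]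
  field_simp

/-- The mean activity as a function of `x = exp s`. -/
noncomputable def meanActivity (μ : ℝ) (L : ℕ) (x : ℝ) : ℝ :=
  1 / (2 * L) * ∑ j ∈ Finset.range L,
    x * (2 * (2 * μ + x) - 2 * Real.cos (momentum L j) - 2 * x * Real.sin (momentum L j) ^ 2) /
      (2 * Real.sqrt (dispersionSq μ x (momentum L j)))

lemma hasDerivAt_activityCGF {μ : ℝ} (hμ : 0 < μ) (s : ℝ) :
    HasDerivAt (activityCGF μ L) (meanActivity μ L (Real.exp s)) s := by
  unfold activityCGF meanActivity
  refine HasDerivAt.sub_const _ (HasDerivAt.const_mul _ (HasDerivAt.fun_sum fun j hj => ?_))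
  have he := Real.hasDerivAt_exp s
  have h1 : HasDerivAt (fun s => dispersionSq μ (Real.exp s) (momentum L j))
      (Real.exp s * (2 * (2 * μ + Real.exp s) - 2 * Real.cos (momentum L j)
        - 2 * Real.exp s * Real.sin (momentum L j) ^ 2)) s := by
    unfold dispersionSq
    have := ((((he.const_add (2 * μ)).mul_const (Real.cos (momentum L j))).const_sub 1).pow 2).add
      ((((he.const_add μ).const_mul μ).const_mul 4).mul_const (Real.sin (momentum L j) ^ 2))
    refine this.congr_deriv ?_
    have hcs := Real.sin_sq_add_cos_sq (momentum L j)
    push_cast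
    linear_combination (4 * μ * Real.exp s + 2 * Real.exp s ^ 2) * hcs
  exact h1.sqrt (dispersionSq_pos hμ (Real.exp_pos s).le (Finset.mem_range.mp hj)).ne'

/-- The formula is continuous in x = exp s up to x = 0, since no mode closes there for μ > 0, and
each term carries a factor x. -/
lemma tendsto_meanActivity_zero {μ : ℝ} (hμ : 0 < μ) :
    Tendsto (fun s => meanActivity μ L (Real.exp s)) atBot (𝓝 0) := by
  have hc : ContinuousAt (meanActivity μ L) 0 := by
    unfold meanActivity
    refine ContinuousAt.mul continuousAt_const (tendsto_finsetSum _ fun j hj => ?_)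
    have hne : 2 * Real.sqrt (dispersionSq μ 0 (momentum L j)) ≠ 0 := by
      have := Real.sqrt_pos.mpr (dispersionSq_pos hμ le_rfl (Finset.mem_range.mp hj))
      positivity
    refine ContinuousAt.div ?_ ?_ hne
    · fun_prop
    · unfold dispersionSq; fun_prop
  have h := hc.tendsto.comp Real.tendsto_exp_atBot
  rwa [show meanActivity μ L 0 = 0 by simp [meanActivity]] at h

end CumulantGeneratingFunction

/-! ### Finite-size expansion at the critical point -/

section CriticalAsymptotics

variable {ν : ℝ}

lemma one_sub_sq_mul_cos_sq_pos (hν0 : 0 ≤ ν) (hν1 : ν < 1) (θ : ℝ) :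
    0 < 1 - ν ^ 2 * Real.cos θ ^ 2 := by
  have h1 : ν ^ 2 < 1 := by nlinarith
  have h2 := Real.cos_sq_le_one θ
  nlinarith [sq_nonneg ν, sq_nonneg (Real.cos θ)]

/-- The critical activity per mode, without the factor `sin`. -/
noncomputable def criticalFactor (ν θ : ℝ) : ℝ :=
  (1 - 2 * ν * Real.cos θ ^ 2) / Real.sqrt (1 - ν ^ 2 * Real.cos θ ^ 2)

/-- The critical activity per mode at half momentum `θ`. -/
noncomputable def criticalDensity (ν θ : ℝ) : ℝ := Real.sin θ * criticalFactor ν θ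

/-- A primitive of `criticalDensity`. -/
noncomputable def criticalPrimitive (ν θ : ℝ) : ℝ :=
  (1 - ν) / ν ^ 2 * Real.arcsin (ν * Real.cos θ)
    - Real.cos θ * Real.sqrt (1 - ν ^ 2 * Real.cos θ ^ 2) / ν

lemma contDiff_criticalFactor (hν0 : 0 ≤ ν) (hν1 : ν < 1) : ContDiff ℝ ⊤ (criticalFactor ν) := by
  unfold criticalFactor
  have h := one_sub_sq_mul_cos_sq_pos hν0 hν1
  refine ContDiff.div ?_ (ContDiff.sqrt ?_ fun θ => (h θ).ne') fun θ => (Real.sqrt_pos.mpr (h θ)).ne'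
  · have := Real.contDiff_cos (n := ⊤); fun_prop
  · have := Real.contDiff_cos (n := ⊤); fun_prop

lemma contDiff_criticalDensity (hν0 : 0 ≤ ν) (hν1 : ν < 1) :
    ContDiff ℝ ⊤ (criticalDensity ν) :=
  Real.contDiff_sin.mul (contDiff_criticalFactor hν0 hν1)

lemma hasDerivAt_criticalPrimitive (hν0 : 0 < ν) (hν1 : ν < 1) (θ : ℝ) :
    HasDerivAt (criticalPrimitive ν) (criticalDensity ν θ) θ := by
  have hpos := one_sub_sq_mul_cos_sq_pos hν0.le hν1 θ
  have hc := Real.hasDerivAt_cos θ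
  have hs : (ν * Real.cos θ) ^ 2 < 1 := by rw [mul_pow]; linarith
  have h1 := abs_lt.mp ((sq_lt_one_iff_abs_lt_one _).mp hs)
  have ha := (Real.hasDerivAt_arcsin h1.1.ne' h1.2.ne).comp θ (hc.const_mul ν)
  have hr := (((hc.pow 2).const_mul (ν ^ 2)).const_sub 1).sqrt hpos.ne'
  have := (ha.const_mul ((1 - ν) / ν ^ 2)).sub ((hc.mul hr).div_const ν)
  refine this.congr_deriv ?_
  have hR := Real.sq_sqrt hpos.le
  have hR0 := Real.sqrt_pos.mpr hpos
  simp only [criticalDensity, criticalFactor, mul_pow, Pi.pow_apply]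
  set R := Real.sqrt (1 - ν ^ 2 * Real.cos θ ^ 2)
  field_simp
  push_cast
  rw [hR]
  ring

/-- Smoothness and period 2π give the global bound on the fourth derivative needed by the midpoint
rule. -/
lemma exists_iteratedDeriv_bound (hν0 : 0 ≤ ν) (hν1 : ν < 1) (n : ℕ) :
    ∃ M, ∀ θ, |iteratedDeriv n (criticalDensity ν) θ| ≤ M := by
  have hper : Function.Periodic (iteratedDeriv n (criticalDensity ν)) (2 * Real.pi) := by
    intro θ
    have h : (fun z => criticalDensity ν (z + 2 * Real.pi)) = criticalDensity ν := by
      funext z; simp [criticalDensity, criticalFactor]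
    have h2 := congrFun (iteratedDeriv_comp_add_const n (criticalDensity ν) (2 * Real.pi)) θ
    rw [h] at h2
    exact h2.symm
  have hcont : Continuous (iteratedDeriv n (criticalDensity ν)) :=
    (contDiff_criticalDensity hν0 hν1).continuous_iteratedDeriv n le_top
  obtain ⟨M, hM⟩ := (isCompact_Icc (a := (0 : ℝ)) (b := 2 * Real.pi)).exists_bound_of_continuousOn
    hcont.continuousOn
  refine ⟨M, fun θ => ?_⟩
  obtain ⟨y, hy, hxy⟩ := hper.exists_mem_Ico₀ Real.two_pi_pos θ
  rw [hxy]
  exact hM y (Set.Ico_subset_Icc_self hy)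

lemma hasDerivAt_iteratedDeriv (hν0 : 0 ≤ ν) (hν1 : ν < 1) (n : ℕ) (θ : ℝ) :
    HasDerivAt (iteratedDeriv n (criticalDensity ν)) (iteratedDeriv (n + 1) (criticalDensity ν) θ)
      θ := by
  rw [iteratedDeriv_succ]
  exact ((contDiff_criticalDensity hν0 hν1).differentiable_iteratedDeriv n
    (by exact_mod_cast WithTop.coe_lt_top _)).differentiableAt.hasDerivAt

lemma deriv_criticalDensity (hν0 : 0 ≤ ν) (hν1 : ν < 1) {θ : ℝ} (hθ : Real.sin θ = 0) :
    iteratedDeriv 1 (criticalDensity ν) θ = Real.cos θ * criticalFactor ν θ := by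
  rw [iteratedDeriv_one]
  have h := ((contDiff_criticalFactor hν0 hν1).differentiable (by simp)).differentiableAt (x := θ)
  have := (Real.hasDerivAt_sin θ).mul h.hasDerivAt
  rw [hθ, zero_mul, add_zero] at this
  exact this.deriv

/-- At x = ν one has 2μ + x = 1 and 4μ(μ + x) = 1 - ν², so the squared dispersion factors as 4 sin²θ
(1 - ν² cos²θ). Positivity of sin θ at the nodes resolves the root, leaving a smooth summand; the
cusp at zero momentum survives only as endpoint slopes. -/
lemma meanActivity_critical (hν0 : 0 < ν) (hν1 : ν < 1) (L : ℕ) :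
    meanActivity ((1 - ν) / 2) L ν = ν / (2 * L) *
      ∑ j ∈ Finset.range L, criticalDensity ν (Real.pi * (2 * j + 1) / (2 * L)) := by
  unfold meanActivity
  rw [Finset.mul_sum, Finset.mul_sum]
  refine Finset.sum_congr rfl fun j hj => ?_
  have hjL : j < L := Finset.mem_range.mp hj
  have hL : (0 : ℝ) < L := by exact_mod_cast (by omega : 0 < L)
  set θ := Real.pi * (2 * j + 1) / (2 * L) with hθ
  have hq : momentum L j = 2 * θ := by rw [momentum, hθ]; field_simp
  have hpos := one_sub_sq_mul_cos_sq_pos hν0.le hν1 θ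
  have hsin : 0 < Real.sin θ := by
    refine Real.sin_pos_of_pos_of_lt_pi (by positivity) ?_
    rw [hθ, div_lt_iff₀ (by positivity)]
    have : (j : ℝ) + 1 ≤ L := by exact_mod_cast hjL
    nlinarith [Real.pi_pos]
  have hcs := Real.sin_sq_add_cos_sq θ
  have hc : Real.cos (2 * θ) = 1 - 2 * Real.sin θ ^ 2 := by
    rw [Real.cos_two_mul]; linear_combination 2 * hcs
  have hd : dispersionSq ((1 - ν) / 2) ν (2 * θ) =
      (2 * Real.sin θ) ^ 2 * (1 - ν ^ 2 * Real.cos θ ^ 2) := by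
    rw [dispersionSq, hc, Real.sin_two_mul]
    linear_combination (4 * Real.sin θ ^ 2) * hcs
  rw [hq, hd, Real.sqrt_mul (by positivity), Real.sqrt_sq (by positivity), hc, Real.sin_two_mul,
    criticalDensity, criticalFactor]
  have hR0 := Real.sqrt_pos.mpr hpos
  field_simp
  ring

lemma criticalPrimitive_sub (hν0 : 0 < ν) :
    ν / (2 * Real.pi) * (criticalPrimitive ν Real.pi - criticalPrimitive ν 0) = kappaStarOne ν := by
  have hpi := Real.pi_pos
  rw [kappaStarOne, if_neg hν0.ne', criticalPrimitive, criticalPrimitive, Real.cos_pi, Real.cos_zero,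
    mul_neg_one, Real.arcsin_neg, mul_one]
  norm_num
  field_simp
  ring

/-- The finite-size expansion of the critical mean activity. -/
lemma isBigO_meanActivity_critical (hν0 : 0 < ν) (hν1 : ν < 1) :
    (fun L : ℕ => meanActivity ((1 - ν) / 2) L ν - (kappaStarOne ν
      + ν * (1 - 2 * ν) / Real.sqrt (1 - ν ^ 2) * (Real.pi / (24 * (L : ℝ) ^ 2))))
      =O[atTop] fun L : ℕ => 1 / (L : ℝ) ^ 4 := by
  obtain ⟨M, hM⟩ := exists_iteratedDeriv_bound hν0.le hν1 4
  have hF : ∀ x, HasDerivAt (criticalPrimitive ν) (iteratedDeriv 0 (criticalDensity ν) x) x := by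
    intro x; rw [iteratedDeriv_zero]; exact hasDerivAt_criticalPrimitive hν0 hν1 x
  refine IsBigO.of_bound (ν / (2 * Real.pi) * (7 / 96 * M * Real.pi ^ 5)) ?_
  filter_upwards [eventually_gt_atTop 0] with L hL
  have hL' : (0 : ℝ) < L := by exact_mod_cast hL
  have hpi := Real.pi_pos
  have h := abs_midpoint_sum_le hF (hasDerivAt_iteratedDeriv hν0.le hν1) hM hpi.le hL
  rw [deriv_criticalDensity hν0.le hν1 Real.sin_pi, deriv_criticalDensity hν0.le hν1 Real.sin_zero,
    iteratedDeriv_zero] at h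
  have h2 := mul_le_mul_of_nonneg_left h (by positivity : 0 ≤ ν / (2 * Real.pi))
  rw [← abs_of_nonneg (by positivity : 0 ≤ ν / (2 * Real.pi)), ← abs_mul,
    abs_of_nonneg (by positivity : 0 ≤ ν / (2 * Real.pi))] at h2
  rw [Real.norm_eq_abs, Real.norm_eq_abs, abs_of_pos (by positivity : 0 < 1 / (L : ℝ) ^ 4),
    meanActivity_critical hν0 hν1, ← criticalPrimitive_sub hν0]
  refine le_trans (le_of_eq ?_) (h2.trans (le_of_eq ?_))
  -- The slopes at π and 0 are opposite, differing by -2(1 - 2ν)/√(1 - ν²); the factor ν/(2π) ·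
  -- π²/(24 L²) turns this into the stated coefficient.
  · congr 1
    simp only [criticalFactor, Real.cos_pi, Real.cos_zero]
    norm_num
    field_simp
    ring
  · ring

end CriticalAsymptotics

end DLPAD

/-! ### Assembly of the theorem -/

theorem mainTheorem4 (ν : ℝ) (hν0 : 0 ≤ ν) (hν1 : ν < 1) :
    ∃ (K A : ℕ → ℝ → ℝ) (Ac : ℕ → ℝ),
      -- `K L` is the limiting cumulant generating function, `A L` the mean activity
      (∀ (L : ℕ) [NeZero L], 2 ≤ L →
        DLPAD.IsEvenCGF (1 / 2) ((1 - ν) / 2) L (K L) ∧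
        ∀ s : ℝ, HasDerivAt (K L) (A L s) s) ∧
      -- `Ac L` is the mean activity at the critical point, which is `-∞` for `ν = 0`
      (0 < ν → ∀ L : ℕ, 2 ≤ L → Ac L = A L (DLPAD.criticalPoint (1 / 2) ((1 - ν) / 2))) ∧
      (ν = 0 → ∀ L : ℕ, 2 ≤ L → Tendsto (A L) atBot (𝓝 (Ac L))) ∧
      (fun L : ℕ => Ac L - (DLPAD.kappaStarOne ν
          + ν * (1 - 2 * ν) / Real.sqrt (1 - ν ^ 2) * (Real.pi / (24 * (L : ℝ) ^ 2))))
        =O[atTop] fun L : ℕ => 1 / (L : ℝ) ^ 4 := by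
  have hμ : 0 < (1 - ν) / 2 := by linarith
  refine ⟨DLPAD.activityCGF ((1 - ν) / 2),
    fun L s => DLPAD.meanActivity ((1 - ν) / 2) L (Real.exp s),
    -- Since exp(s_c) = ν, evaluation at x = ν also covers ν = 0, where x = 0 stands for s = -∞.
    fun L => DLPAD.meanActivity ((1 - ν) / 2) L ν, fun L _ hL =>
      ⟨DLPAD.isEvenCGF_activityCGF hL hμ, DLPAD.hasDerivAt_activityCGF hμ⟩, fun hν L _ => ?_,
      fun hν L _ => ?_, ?_⟩
  · have h : 1 - (1 - ν) / 2 / (1 / 2) = ν := by ring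
    simp only [DLPAD.criticalPoint, h, Real.exp_log hν]
  · have h0 : DLPAD.meanActivity ((1 - ν) / 2) L ν = 0 := by simp [hν, DLPAD.meanActivity]
    simp only [h0]
    exact DLPAD.tendsto_meanActivity_zero hμ
  · rcases hν0.eq_or_lt with rfl | hν
    · refine (isBigO_zero _ _).congr_left fun L => ?_
      simp [DLPAD.meanActivity, DLPAD.kappaStarOne]
    · exact DLPAD.isBigO_meanActivity_critical hν hν1
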